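/- Let $K$ be a nonarchimedean local field with canonical absolute value $|\cdot|$, closed unit ball $R=\{x\in K:|x|\le 1\}$, open unit ball $P=\{x\in K:|x|<1\}$ and $q=\#(R/P)$ (so $|\pi|=1/q$ for any uniformizer $\pi$), and let $\mu$ be the additive Haar measure on $K$ with $\mu(R)=1$. On the projective line $\mathbb P^1(K)$ let $\delta([x_0:x_1],[y_0:y_1])=\dfrac{|x_0y_1-x_1y_0|}{\max\{|x_0|,|x_1|\}\max\{|y_0|,|y_1|\}}$ be the spherical metric and $\nu$ the unique $PGL_2(R)$-invariant Borel probability measure. For $N\ge 1$ and $\beta\in\mathbb C$ put $$Z_N(R,\beta)=\int_{R^N}\prod_{1\le i<j\le N}|x_i-x_j|^{\beta}\,d\mu^N,\qquad Z_N(\mathbb P^1(K),\beta)=\int_{\mathbb P^1(K)^N}\prod_{1\le i<j\le N}\delta(x_i,x_j)^{\beta}\,d\nu^N .$$ Define $F_N(t,\beta)$ for $t\in\mathbb R$ by $F_0=F_1=1$ and, for $N\ge 2$ and $\operatorname{Re}\beta>-2/N$, $$F_N(t,\beta)=\sum_{k=1}^{N-1}\frac kN\cdot\frac{\sinh\left(\frac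 t2\left[\left(N+\binom N2\beta\right)\left(1-\frac{2k}N\right)+1\right]\right)}{\sinh\left(\frac t2\left[\left(N+\binom N2\beta\right)-1\right]\right)}\,F_{N-k}(t,\beta)\,F_k(t,\beta)\qquad(t\ne 0),$$ where at $t=0$ the quotient of hyperbolic sines is replaced by $\dfrac{\left(N+\binom N2\beta\right)\left(1-\frac{2k}N\right)+1}{\left(N+\binom N2\beta\right)-1}$. **Theorem 2.5 (Efficient Formulas and Functional Equations).** Suppose $N\ge 2$ and $\operatorname{Re}\beta>-2/N$. Then both integrals converge absolutely, and $$Z_N(R,\beta)=N!\,q^{\frac12\binom N2\beta}F_N(\log q,\beta),$$ $$Z_N(\mathbb P^1(K),\beta)=N!\sum_{k=0}^N\frac{\cosh\left(\frac{\log q}2\left(N+\binom N2\beta\right)\left(1-\frac{2k}N\right)\right)}{\left(2\cosh\left(\frac{\log q}2\right)\right)^N}\,F_{N-k}(\log q,\beta)\,F_k(\log q,\beta).$$ The right-hand sides, as functions of a real variable $q\in(0,\infty)$, are smooth, so they extend $Z_N(R,\beta)$ and $Z_N(\mathbb P^1(K),\beta)$ to smooth functions of $q\in(0,\infty)$, and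 these extensions satisfy $$Z_N(R,\beta)\big|_{q\mapsto q^{-1}}=q^{-\binom N2\beta}Z_N(R,\beta),\qquad Z_N(\mathbb P^1(K),\beta)\big|_{q\mapsto q^{-1}}=Z_N(\mathbb P^1(K),\beta).$$ -/

import Mathlib

open MeasureTheory Set
open scoped ContDiff LinearAlgebra.Projectivization MatrixGroups

noncomputable section

namespace LogCoulomb

/-! ### The canonical partition function of a one-component log-Coulomb gas -/

/-- The integrand `∏_{i<j} d(x_i, x_j)^β` of the `N`-particle canonical partition function
(all charges equal to `1`, complex inverse temperature `β`). -/
def density {X : Type*} (d : X → X → ℝ) (N : ℕ) (β : ℂ) (x : Fin N → X) : ℂ :=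
  ∏ i : Fin N, ∏ j ∈ Finset.Ioi i, ((d (x i) (x j) : ℝ) : ℂ) ^ β

/-- The canonical partition function
`Z_N(X, β) = ∫_{X^N} ∏_{i<j} d(x_i, x_j)^β dμ^N`. -/
def partitionFunction {X : Type*} [MeasurableSpace X] (d : X → X → ℝ) (μ : Measure X)
    (N : ℕ) (β : ℂ) : ℂ :=
  ∫ x : Fin N → X, density d N β x ∂(Measure.pi fun _ : Fin N => μ)

/-! ### Nonarchimedean local fields -/

section Field

variable (K : Type*) [NontriviallyNormedField K] [IsUltrametricDist K]

/-- The closed unit ball `R = {x : |x| ≤ 1}`, as a subring of `K`. -/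
def integers : Subring K where
  carrier := {x | ‖x‖ ≤ 1}
  mul_mem' {a b} ha hb := by
    simp only [mem_ofPred_eq, norm_mul] at *
    exact mul_le_one₀ ha (norm_nonneg b) hb
  one_mem' := by simp
  add_mem' {a b} ha hb := (IsUltrametricDist.norm_add_le_max a b).trans (max_le ha hb)
  zero_mem' := by simp
  neg_mem' {a} ha := by simpa using ha

/-- The open unit ball `P = {x : |x| < 1}`, as an ideal of `R`. -/
def maxIdeal : Ideal (integers K) where
  carrier := {x | ‖(x : K)‖ < 1}
  add_mem' {a b} ha hb := by
    simpa using (IsUltrametricDist.norm_add_le_max (a : K) (b : K)).trans_lt (max_lt ha hb)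
  zero_mem' := by simp
  smul_mem' c x hx := by
    have hc : ‖(c : K)‖ ≤ 1 := c.2
    have hx' : ‖(x : K)‖ < 1 := hx
    simpa using (mul_le_of_le_one_left (norm_nonneg (x : K)) hc).trans_lt hx'

/-- The number `q` of elements of the residue field `R / P`. -/
def residueCard : ℕ := Nat.card (integers K ⧸ maxIdeal K)

/-- The norm of `K` is its canonical absolute value: a uniformizer `π` (an element with `P = πR`)
has absolute value `1 / q`. -/
def HasCanonicalNorm : Prop :=
  ∃ π : integers K, maxIdeal K = Ideal.span {π} ∧ ‖(π : K)‖ = (residueCard K : ℝ)⁻¹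

/-- The restriction to `R` of the additive Haar measure `μ` on `K` with `μ(R) = 1`. -/
def haarOnIntegers [LocallyCompactSpace K] [MeasurableSpace K] [BorelSpace K] : Measure K :=
  ((Measure.addHaar (integers K : Set K))⁻¹ • (Measure.addHaar : Measure K)).restrict
    (integers K : Set K)

end Field

/-! ### The projective line -/

section ProjLine

variable (K : Type*) [NontriviallyNormedField K]

/-- The projective line `P¹(K)`: nonzero vectors of `K²` up to nonzero scalars. -/
abbrev ProjLine : Type _ := ℙ K (Fin 2 → K)

/-- The quotient topology on `P¹(K)`. -/
instance instTopologicalSpaceProjLine : TopologicalSpace (ProjLine K) :=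
  TopologicalSpace.coinduced (Projectivization.mk' K (V := Fin 2 → K)) inferInstance

/-- The Borel `σ`-algebra on `P¹(K)`. -/
instance instMeasurableSpaceProjLine : MeasurableSpace (ProjLine K) := borel _

instance instBorelSpaceProjLine : BorelSpace (ProjLine K) := ⟨rfl⟩

variable {K}

/-- The spherical metric
`δ([x₀:x₁],[y₀:y₁]) = |x₀y₁ - x₁y₀| / (max(|x₀|,|x₁|) max(|y₀|,|y₁|))`, computed with
representatives; by `sphDist_mk` their choice does not matter. -/
def sphDist (x y : ProjLine K) : ℝ :=
  ‖x.rep 0 * y.rep 1 - x.rep 1 * y.rep 0‖ /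
    (max ‖x.rep 0‖ ‖x.rep 1‖ * max ‖y.rep 0‖ ‖y.rep 1‖)

theorem sphDist_mk (v w : Fin 2 → K) (hv : v ≠ 0) (hw : w ≠ 0) :
    sphDist (Projectivization.mk K v hv) (Projectivization.mk K w hw) =
      ‖v 0 * w 1 - v 1 * w 0‖ / (max ‖v 0‖ ‖v 1‖ * max ‖w 0‖ ‖w 1‖) := by
  obtain ⟨a, ha⟩ := Projectivization.exists_smul_eq_mk_rep K v hv
  obtain ⟨b, hb⟩ := Projectivization.exists_smul_eq_mk_rep K w hw
  have ha0 : ‖(a : K)‖ ≠ 0 := by simp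
  have hb0 : ‖(b : K)‖ ≠ 0 := by simp
  unfold sphDist
  rw [← ha, ← hb]
  simp only [Pi.smul_apply, Units.smul_def, smul_eq_mul, norm_mul]
  rw [← mul_max_of_nonneg _ _ (norm_nonneg _), ← mul_max_of_nonneg _ _ (norm_nonneg _)]
  rw [show (a : K) * v 0 * (b * w 1) - a * v 1 * (b * w 0)
    = a * b * (v 0 * w 1 - v 1 * w 0) by ring, norm_mul, norm_mul]
  rw [mul_mul_mul_comm, mul_div_mul_left _ _ (mul_ne_zero ha0 hb0)]

variable (K) [IsUltrametricDist K]

/-- A Borel probability measure on `P¹(K)` that is invariant under `PGL₂(R)`. The action of a class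
in `PGL₂(R)` is that of any matrix in `GL₂(R)` representing it. -/
structure IsInvariantProbability (ν : Measure (ProjLine K)) : Prop where
  isProbabilityMeasure : IsProbabilityMeasure ν
  invariant : ∀ (g : GL (Fin 2) (integers K)) (M : Set (ProjLine K)), MeasurableSet M →
    ν ((fun x => Matrix.GeneralLinearGroup.map (integers K).subtype g • x) '' M) = ν M

end ProjLine


section Existence

variable (K : Type*) [NontriviallyNormedField K]

open Classical in
/-- The class of a vector in `P¹(K)`, with an arbitrary value at `0`. -/
def toProj (v : Fin 2 → K) : ProjLine K :=
  if h : v ≠ 0 then Projectivization.mk K v h else Classical.arbitrary _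

theorem continuousOn_toProj : ContinuousOn (toProj K) {v | ‖v‖ = 1} := by
  have hne : ∀ v : {v : Fin 2 → K | ‖v‖ = 1}, (v : Fin 2 → K) ≠ 0 := by
    rintro ⟨v, hv⟩ rfl
    simp at hv
  rw [continuousOn_iff_continuous_domRestrict]
  have h1 : Continuous (Projectivization.mk' K (V := Fin 2 → K)) := continuous_coinduced_rng
  have h2 : Continuous fun v : {v : Fin 2 → K | ‖v‖ = 1} =>
      (⟨(v : Fin 2 → K), hne v⟩ : {w : Fin 2 → K // w ≠ 0}) :=
    continuous_subtype_val.subtype_mk _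
  refine (h1.comp h2).congr fun v => ?_
  simp [toProj, hne v]

variable {K} [IsUltrametricDist K]

theorem norm_smul_le (g : GL (Fin 2) (integers K)) (v : Fin 2 → K) :
    ‖Matrix.GeneralLinearGroup.map (integers K).subtype g • v‖ ≤ ‖v‖ := by
  have key : ∀ a b : integers K, ‖(a : K) * v 0 + (b : K) * v 1‖ ≤ ‖v‖ := by
    intro a b
    refine (IsUltrametricDist.norm_add_le_max _ _).trans (max_le ?_ ?_)
    · rw [norm_mul]
      exact (mul_le_of_le_one_left (norm_nonneg _) a.2).trans (norm_le_pi_norm v 0)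
    · rw [norm_mul]
      exact (mul_le_of_le_one_left (norm_nonneg _) b.2).trans (norm_le_pi_norm v 1)
  rw [Matrix.GeneralLinearGroup.fin_two_smul, pi_norm_le_iff_of_nonneg (norm_nonneg _)]
  intro i
  fin_cases i
  · exact key (g 0 0) (g 0 1)
  · exact key (g 1 0) (g 1 1)

theorem norm_smul_eq (g : GL (Fin 2) (integers K)) (v : Fin 2 → K) :
    ‖Matrix.GeneralLinearGroup.map (integers K).subtype g • v‖ = ‖v‖ := by
  refine le_antisymm (norm_smul_le g v) ?_
  have h := norm_smul_le g⁻¹ (Matrix.GeneralLinearGroup.map (integers K).subtype g • v)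
  rwa [map_inv, inv_smul_smul] at h

/-- The action of a matrix in `GL₂(R)` on `K²`. -/
def glHomeo (g : GL (Fin 2) (integers K)) : (Fin 2 → K) ≃ₜ (Fin 2 → K) where
  toFun v := Matrix.GeneralLinearGroup.map (integers K).subtype g • v
  invFun v := (Matrix.GeneralLinearGroup.map (integers K).subtype g)⁻¹ • v
  left_inv v := inv_smul_smul _ v
  right_inv v := smul_inv_smul _ v
  continuous_toFun := by
    simp only [Units.smul_def, Matrix.smul_eq_mulVec]
    exact Continuous.matrix_mulVec continuous_const continuous_id
  continuous_invFun := by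
    simp only [Units.smul_def, Matrix.smul_eq_mulVec]
    exact Continuous.matrix_mulVec continuous_const continuous_id

variable (K)

/-- A `PGL₂(R)`-invariant Borel probability measure on `P¹(K)` exists: push the Haar measure on the
unit sphere of `K²` forward to `P¹(K)`. -/
theorem exists_isInvariantProbability [LocallyCompactSpace K] :
    ∃ ν : Measure (ProjLine K), IsInvariantProbability K ν := by
  have : ProperSpace K := .of_nontriviallyNormedField_of_weaklyLocallyCompactSpace K
  let _ : MeasurableSpace (Fin 2 → K) := borel _
  have _ : BorelSpace (Fin 2 → K) := ⟨rfl⟩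
  set B : TopologicalSpace.PositiveCompacts (Fin 2 → K) :=
    ⟨⟨Metric.closedBall 0 1, isCompact_closedBall 0 1⟩,
      ⟨0, mem_interior_iff_mem_nhds.2 (Metric.closedBall_mem_nhds 0 one_pos)⟩⟩ with hB
  set m : Measure (Fin 2 → K) := Measure.addHaarMeasure B with hm
  set S : Set (Fin 2 → K) := {v | ‖v‖ = 1} with hS
  have hSeq : S = Metric.sphere 0 1 := by ext v; simp [hS]
  have hSm : MeasurableSet S := by rw [hSeq]; exact Metric.isClosed_sphere.measurableSet
  have hSo : IsOpen S := by
    rw [hSeq]; exact IsUltrametricDist.isOpen_sphere _ one_ne_zero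
  have hS0 : m S ≠ 0 := (hSo.measure_pos m ⟨fun _ => 1, by simp [hS]⟩).ne'
  have hST : m S ≠ ⊤ := by
    rw [hSeq]; exact (isCompact_sphere _ _).measure_ne_top
  have hpm : AEMeasurable (toProj K) (m.restrict S) :=
    (continuousOn_toProj K).aemeasurable hSm
  have hmg : ∀ (g : GL (Fin 2) (integers K)) (A : Set (Fin 2 → K)),
      m (glHomeo g ⁻¹' A) = m A := by
    intro g A
    have e : m.map (glHomeo g) = m := by
      have hinv : (m.map (glHomeo g)).IsAddLeftInvariant := by
        refine ⟨fun v => ?_⟩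
        have hg : ∀ a b, glHomeo g (a + b) = glHomeo g a + glHomeo g b := 
          fun a b => smul_add (Matrix.GeneralLinearGroup.map (integers K).subtype g) a b
        rw [Measure.map_map (measurable_const_add v) (glHomeo g).measurable]
        obtain ⟨w, rfl⟩ := (glHomeo g).surjective v
        have : (fun x => glHomeo g w + x) ∘ glHomeo g = glHomeo g ∘ fun x => w + x := by
          funext x; simp [hg]
        rw [this, ← Measure.map_map (glHomeo g).measurable (measurable_const_add w),
          map_add_left_eq_self]
      have hB1 : (m.map (glHomeo g)) B = 1 := by
        refine ((glHomeo g).toMeasurableEquiv.map_apply _).trans ?_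
        have : (glHomeo g).toMeasurableEquiv ⁻¹' (B : Set (Fin 2 → K)) = B := by
          ext v
          change glHomeo g v ∈ Metric.closedBall 0 1 ↔ v ∈ Metric.closedBall 0 1
          simp only [mem_closedBall_zero_iff]
          exact (norm_smul_eq g v) ▸ Iff.rfl
        rw [this]
        exact Measure.addHaarMeasure_self
      have : SigmaFinite (m.map (glHomeo g)) := (glHomeo g).toMeasurableEquiv.sigmaFinite_map
      rw [Measure.addHaarMeasure_unique (m.map (glHomeo g)) B, hB1, one_smul]
    conv_rhs => rw [← e]
    exact ((glHomeo g).toMeasurableEquiv.map_apply A).symm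
  refine ⟨(m S)⁻¹ • (m.restrict S).map (toProj K), ⟨⟨?_⟩, ?_⟩⟩
  · rw [Measure.smul_apply, Measure.map_apply_of_aemeasurable hpm MeasurableSet.univ]
    simp [ENNReal.inv_mul_cancel hS0 hST]
  · intro g M hM
    set γ := Matrix.GeneralLinearGroup.map (integers K).subtype g with hγ
    have hcont : Continuous fun x : ProjLine K => γ⁻¹ • x := by
      have h1 : Continuous (Projectivization.mk' K (V := Fin 2 → K)) := continuous_coinduced_rng
      refine continuous_coinduced_dom.2 ?_
      have h2 : Continuous fun v : {w : Fin 2 → K // w ≠ 0} =>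
          (⟨γ⁻¹ • (v : Fin 2 → K), (smul_ne_zero_iff_ne γ⁻¹).mpr v.2⟩ :
            {w : Fin 2 → K // w ≠ 0}) :=
        ((glHomeo g).symm.continuous.comp continuous_subtype_val).subtype_mk _
      exact h1.comp h2
    have himg : (fun x => γ • x) '' M = (fun x => γ⁻¹ • x) ⁻¹' M := by
      ext x
      constructor
      · rintro ⟨y, hy, rfl⟩
        simpa using hy
      · intro hx
        exact ⟨γ⁻¹ • x, hx, smul_inv_smul γ x⟩
    have hM' : MeasurableSet ((fun x => γ • x) '' M) := by
      rw [himg]; exact hcont.measurable hM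
    rw [Measure.smul_apply, Measure.smul_apply, Measure.map_apply_of_aemeasurable hpm hM',
      Measure.map_apply_of_aemeasurable hpm hM, Measure.restrict_apply' hSm,
      Measure.restrict_apply' hSm, ← hmg g (toProj K ⁻¹' ((fun x => γ • x) '' M) ∩ S)]
    congr 2
    ext v
    have hn : ‖glHomeo g v‖ = ‖v‖ := norm_smul_eq g v
    simp only [mem_preimage, mem_inter_iff, hS, mem_ofPred_eq, hn, and_congr_left_iff]
    intro hv
    have hv0 : v ≠ 0 := by rintro rfl; simp at hv
    have hgv : glHomeo g v ≠ 0 := by rw [← norm_ne_zero_iff, hn, hv]; exact one_ne_zero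
    have hp : toProj K (glHomeo g v) = γ • toProj K v := by
      simp only [toProj, dif_pos hv0, dif_pos hgv]
      rfl
    rw [himg, mem_preimage, hp, inv_smul_smul]

/-- The `PGL₂(R)`-invariant Borel probability measure `ν` on `P¹(K)`, which is unique. -/
def projMeasure [LocallyCompactSpace K] : Measure (ProjLine K) :=
  (exists_isInvariantProbability K).choose

theorem projMeasure_isInvariantProbability [LocallyCompactSpace K] :
    IsInvariantProbability K (projMeasure K) :=
  (exists_isInvariantProbability K).choose_spec

end Existence

/-! ### The quadratic recurrence and the two closed formulas -/

/-- The exponent `N + (N choose 2) β`. -/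
def expo (N : ℕ) (β : ℂ) : ℂ := N + (N.choose 2 : ℂ) * β

/-- The functions `F_N(t, β)`: `F_0 = F_1 = 1`, and for `N ≥ 2` the quadratic recurrence
`F_N = ∑_{k=1}^{N-1} (k/N) (sinh(t/2 [e(1-2k/N)+1]) / sinh(t/2 [e-1])) F_{N-k} F_k` with
`e = N + (N choose 2) β`, where at `t = 0` the quotient of hyperbolic sines is replaced by the
quotient of their arguments. -/
def F (N : ℕ) (t : ℝ) (β : ℂ) : ℂ :=
  if N ≤ 1 then 1
  else ∑ k : {k : ℕ // k ∈ Finset.Icc 1 (N - 1)},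
    ((k : ℕ) : ℂ) / N *
      (if t = 0 then
        (expo N β * (1 - 2 * ((k : ℕ) : ℂ) / N) + 1) / (expo N β - 1)
      else
        Complex.sinh ((t : ℂ) / 2 * (expo N β * (1 - 2 * ((k : ℕ) : ℂ) / N) + 1)) /
          Complex.sinh ((t : ℂ) / 2 * (expo N β - 1))) *
      F (N - k) t β * F k t β
termination_by N
decreasing_by
  all_goals
    have := Finset.mem_Icc.1 k.2
    omega

/-- The function `q ↦ N! q^{(N choose 2) β / 2} F_N(log q, β)` of a real variable `q > 0`. -/
def formulaR (N : ℕ) (β : ℂ) (q : ℝ) : ℂ :=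
  (N.factorial : ℂ) * (q : ℂ) ^ ((1 / 2 : ℂ) * (N.choose 2 : ℂ) * β) * F N (Real.log q) β

/-- The function
`q ↦ N! ∑_{k=0}^N cosh((log q / 2) (N + (N choose 2) β) (1 - 2k/N)) / (2 cosh(log q / 2))^N
  · F_{N-k}(log q, β) F_k(log q, β)` of a real variable `q > 0`. -/
def formulaProj (N : ℕ) (β : ℂ) (q : ℝ) : ℂ :=
  (N.factorial : ℂ) * ∑ k ∈ Finset.range (N + 1),
    Complex.cosh ((Real.log q : ℂ) / 2 * expo N β * (1 - 2 * (k : ℂ) / N)) /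
      (2 * Complex.cosh ((Real.log q : ℂ) / 2)) ^ N *
      F (N - k) (Real.log q) β * F k (Real.log q) β

end LogCoulomb

end

namespace LogCoulomb

/-! ### Products over pairs and their integrals -/

section PairProd

variable {ι κ X Y M : Type*}

/-! The ring `R` is the disjoint union of `q` residue classes. Each is a copy of `R` with mass and
distances divided by `q`, and points of different classes are at distance `1`. Distributing `n`
points among the classes gives, for `A(X) = ∑ Z_n X^n / n!` and `e_n = n + (n choose 2) β`, the
identity `A = G^q` with `G(X) = ∑ q^(-e_n) Z_n X^n / n!` (`IsSelfSimilar.pairIntegral_eq`,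
`convPow_eq_coeff`). The logarithmic derivative of this identity is quadratic in the `Z_n`. Solved
for the top coefficient, with half-powers of `q` taken out, it is the recurrence of hyperbolic sines
(`eq_factorial_mul_exp_mul_F`).

Convergence has the same source. For truncated weights the relation bounds the integral at level `M
+ 1` by a constant plus `q^(1 - e_n)`, taken at `Re β`, times the integral at level `M`. This factor
is less than `1` exactly when `Re β > -2/n`. The bound is therefore uniform in `M`, and Fatou's
lemma removes the truncation (`pairIntegrable_normWeight`).

The projective line is the disjoint union of the chart image of `R` and of the open unit ball around
infinity, again at mutual distance `1`. Invariance under integral translations and under the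
inversion forces the measure to be `q/(q+1)` times Haar measure on the first part and `1/(q+1)`
times a rescaled copy on the second (`IsInvariantProbability.eq_add`). So `Z_N(P¹)` is a single
binomial convolution of the integrals over `R`, and averaging with `k ↦ N - k` produces the
hyperbolic cosines.

With `t = log q`, each `F_n` is even and smooth in `t`, because `sinh z / z` is entire and `sinh (t
b / 2)` has no zero at `t ≠ 0` when `Re b > 0`. Evenness gives the functional equations. -/

/-- The product `∏_{i<j} w(x_i, x_j)` over the pairs of a finite linear order. -/
def pairProd [Fintype ι] [LinearOrder ι] [CommMonoid M] (w : X → X → M) (x : ι → X) : M :=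
  ∏ i, ∏ j, if i < j then w (x i) (x j) else 1

theorem density_eq_pairProd (d : X → X → ℝ) (N : ℕ) (β : ℂ) :
    density d N β = pairProd fun a b => ((d a b : ℝ) : ℂ) ^ β := by
  funext x
  refine Finset.prod_congr rfl fun i _ => ?_
  rw [← Finset.prod_filter]
  congr 1
  ext j
  simp

/-- The reindexing must preserve the order, since `w` is not assumed symmetric. It allows the points
indexed by a subset of `Fin n` to be treated as a configuration of `k` points. -/
theorem pairProd_orderIso [Fintype ι] [LinearOrder ι] [Fintype κ] [LinearOrder κ] [CommMonoid M]
    (w : X → X → M) (e : κ ≃o ι) (x : ι → X) : pairProd w (x ∘ e) = pairProd w x := by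
  unfold pairProd
  rw [← e.toEquiv.prod_comp]
  refine Finset.prod_congr rfl fun i _ => ?_
  rw [← e.toEquiv.prod_comp]
  refine Finset.prod_congr rfl fun j _ => ?_
  simp

/-- The mixed pairs contribute `1`. Both orders of the arguments occur in `h` because the smaller
index of a mixed pair may lie on either side. -/
theorem pairProd_subtype_mul [Fintype ι] [LinearOrder ι] [CommMonoid M] (w : X → X → M)
    (p : ι → Prop) [DecidablePred p] (x : ι → X)
    (h : ∀ i j, p i → ¬ p j → w (x i) (x j) = 1 ∧ w (x j) (x i) = 1) :
    pairProd w (fun i : {i // p i} => x i) * pairProd w (fun i : {i // ¬ p i} => x i) =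
      pairProd w x := by
  unfold pairProd
  rw [← Fintype.prod_subtype_mul_prod_subtype p fun i => ∏ j, if i < j then w (x i) (x j) else 1]
  congr 1
  · refine Finset.prod_congr rfl fun i _ => ?_
    rw [← Fintype.prod_subtype_mul_prod_subtype p]
    rw [Finset.prod_eq_one (s := (Finset.univ : Finset {j // ¬ p j})), mul_one]
    · simp
    · intro j _
      simp [(h i j i.2 j.2).1]
  · refine Finset.prod_congr rfl fun i _ => ?_
    rw [← Fintype.prod_subtype_mul_prod_subtype p]
    rw [Finset.prod_eq_one (s := (Finset.univ : Finset {j // p j})), one_mul]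
    · simp
    · intro j _
      simp [(h j i j.2 i.2).2]

theorem prod_pairs_const [CommMonoid M] (n : ℕ) (r : M) :
    (∏ i : Fin n, ∏ j : Fin n, if i < j then r else 1) = r ^ n.choose 2 := by
  have h1 : ∀ i : Fin n, (∏ j : Fin n, if i < j then r else 1) = r ^ (n - 1 - (i : ℕ)) := by
    intro i
    rw [← Finset.prod_filter, Finset.prod_const]
    congr 1
    rw [show (Finset.univ.filter fun j : Fin n => i < j) = Finset.Ioi i by ext; simp]
    simp
  simp_rw [h1]
  rw [Finset.prod_pow_eq_pow_sum, Fin.sum_univ_eq_sum_range (fun i => n - 1 - i) n,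
    Finset.sum_range_reflect (fun i => i) n, Finset.sum_range_id, Nat.choose_two_right]

theorem pairProd_mul_const [CommMonoid M] {n : ℕ} (w : X → X → M) (v : Y → Y → M) (φ : X → Y)
    (r : M) (x : Fin n → X) (h : ∀ i j, i < j → v (φ (x i)) (φ (x j)) = r * w (x i) (x j)) :
    pairProd v (fun i => φ (x i)) = r ^ n.choose 2 * pairProd w x := by
  rw [← prod_pairs_const, pairProd, pairProd, ← Finset.prod_mul_distrib]
  refine Finset.prod_congr rfl fun i _ => ?_
  rw [← Finset.prod_mul_distrib]
  refine Finset.prod_congr rfl fun j _ => ?_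
  split_ifs with hij
  · exact h i j hij
  · simp

theorem measurable_pairProd [Fintype ι] [LinearOrder ι] [CommMonoid M] [MeasurableSpace X]
    [MeasurableSpace M] [MeasurableMul₂ M] {w : X → X → M} (hw : Measurable (Function.uncurry w)) :
    Measurable (pairProd w : (ι → X) → M) := by
  unfold pairProd
  refine Finset.measurable_prod _ fun i _ => Finset.measurable_prod _ fun j _ => ?_
  split_ifs
  · have h2 : Measurable fun x : ι → X => (x i, x j) :=
      (measurable_pi_apply i).prodMk (measurable_pi_apply j)
    exact hw.comp h2
  · exact measurable_const

end PairProd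

/-! ### Integrals of pair products over sums and images of measures -/

section PairIntegral

variable {𝕜 : Type*} [RCLike 𝕜] {X Y : Type*} [MeasurableSpace X]

/-- The integral of `∏_{i<j} w(x_i, x_j)` over `n` points. -/
noncomputable def pairIntegral (w : X → X → 𝕜) (μ : Measure X) (n : ℕ) : 𝕜 :=
  ∫ x : Fin n → X, pairProd w x ∂Measure.pi fun _ => μ

/-- Integrability of `∏_{i<j} w(x_i, x_j)` over `n` points. -/
def PairIntegrable (w : X → X → 𝕜) (μ : Measure X) (n : ℕ) : Prop :=
  Integrable (pairProd w : (Fin n → X) → 𝕜) (Measure.pi fun _ => μ)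

theorem measurePreserving_comp_orderIso {ι : Type*} [Fintype ι] [LinearOrder ι] {n : ℕ}
    (e : Fin n ≃o ι) (μ : Measure X) [SigmaFinite μ] :
    MeasurePreserving (MeasurableEquiv.piCongrLeft (fun _ : ι => X) e.toEquiv)
      (Measure.pi fun _ : Fin n => μ) (Measure.pi fun _ : ι => μ) :=
  measurePreserving_piCongrLeft (fun _ => μ) e.toEquiv

theorem pairProd_piCongrLeft {ι : Type*} [Fintype ι] [LinearOrder ι] {n : ℕ} (w : X → X → 𝕜)
    (e : Fin n ≃o ι) (x : Fin n → X) :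
    pairProd w (MeasurableEquiv.piCongrLeft (fun _ : ι => X) e.toEquiv x) = pairProd w x := by
  rw [← pairProd_orderIso w e]
  congr 1
  funext i
  exact Equiv.piCongrLeft_apply_apply (fun _ : ι => X) e.toEquiv x i

theorem integral_pairProd {ι : Type*} [Fintype ι] [LinearOrder ι] {n : ℕ}
    (hn : Fintype.card ι = n) (w : X → X → 𝕜) (μ : Measure X) [SigmaFinite μ] :
    ∫ x : ι → X, pairProd w x ∂Measure.pi (fun _ => μ) = pairIntegral w μ n := by
  have e := Fintype.orderIsoFinOfCardEq ι hn
  rw [← (measurePreserving_comp_orderIso e μ).integral_comp']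
  simp_rw [pairProd_piCongrLeft]
  rfl

theorem integrable_pairProd {ι : Type*} [Fintype ι] [LinearOrder ι] {n : ℕ}
    (hn : Fintype.card ι = n) {w : X → X → 𝕜} {μ : Measure X} [SigmaFinite μ]
    (h : PairIntegrable w μ n) :
    Integrable (pairProd w : (ι → X) → 𝕜) (Measure.pi fun _ => μ) := by
  have e := Fintype.orderIsoFinOfCardEq ι hn
  rw [← (measurePreserving_comp_orderIso e μ).integrable_comp_emb
    (MeasurableEquiv.measurableEmbedding _)]
  refine h.congr (.of_forall fun x => ?_)
  exact (pairProd_piCongrLeft w e x).symm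

/-- On a box this is the expansion of a product of sums; `U` is the set of coordinates that receive
`μ₁`. -/
theorem pi_add_measure {ι : Type*} [Fintype ι] [DecidableEq ι] (μ₁ μ₂ : Measure X)
    [IsFiniteMeasure μ₁] [IsFiniteMeasure μ₂] :
    Measure.pi (fun _ : ι => μ₁ + μ₂) =
      ∑ U ∈ (Finset.univ : Finset ι).powerset, Measure.pi fun i => if i ∈ U then μ₁ else μ₂ := by
  have : ∀ (U : Finset ι) i, IsFiniteMeasure (if i ∈ U then μ₁ else μ₂) := by
    intro U i; split_ifs <;> infer_instance
  refine Measure.pi_eq fun s _ => ?_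
  simp only [Measure.finsetSum_apply, Measure.pi_pi, Measure.add_apply, Finset.prod_add]
  refine Finset.sum_congr rfl fun U _ => ?_
  rw [← Finset.prod_mul_prod_compl U, ← Finset.compl_eq_univ_sdiff]
  congr 1
  · exact Finset.prod_congr rfl fun i hi => by simp [hi]
  · exact Finset.prod_congr rfl fun i hi => by simp [Finset.mem_compl.1 hi]

/-- The two measures live on sets between which `w` is `1`. -/
def CrossOne (w : X → X → 𝕜) (μ₁ μ₂ : Measure X) : Prop :=
  ∃ A B : Set X, (∀ᵐ x ∂μ₁, x ∈ A) ∧ (∀ᵐ x ∂μ₂, x ∈ B) ∧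
    ∀ x ∈ A, ∀ y ∈ B, w x y = 1 ∧ w y x = 1

/-! ### Distribution of the points between two measures -/

section Piece

variable {n : ℕ} {w : X → X → 𝕜} {μ₁ μ₂ : Measure X} [IsFiniteMeasure μ₁] [IsFiniteMeasure μ₂]

theorem measurePreserving_split (U : Finset (Fin n)) :
    MeasurePreserving (MeasurableEquiv.piEquivPiSubtypeProd (fun _ : Fin n => X) (· ∈ U))
      (Measure.pi fun i => if i ∈ U then μ₁ else μ₂)
      ((Measure.pi fun _ : {i // i ∈ U} => μ₁).prod (Measure.pi fun _ : {i // i ∉ U} => μ₂)) := by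
  have : ∀ i, IsFiniteMeasure (if i ∈ U then μ₁ else μ₂) := by
    intro i; split_ifs <;> infer_instance
  convert measurePreserving_piEquivPiSubtypeProd
    (fun i : Fin n => if i ∈ U then μ₁ else μ₂) (· ∈ U) using 3
  · funext i; simp [i.2]
  · funext i; simp [i.2]

theorem pairProd_split_ae (h : CrossOne w μ₁ μ₂) (U : Finset (Fin n)) :
    (fun x : Fin n → X => pairProd w (fun i : {i // i ∈ U} => x i) *
        pairProd w (fun i : {i // i ∉ U} => x i)) =ᵐ[Measure.pi fun i =>
          if i ∈ U then μ₁ else μ₂] pairProd w := by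
  have : ∀ i, IsFiniteMeasure (if i ∈ U then μ₁ else μ₂) := by
    intro i; split_ifs <;> infer_instance
  obtain ⟨A, B, hA, hB, hAB⟩ := h
  have key : ∀ᵐ x ∂(Measure.pi fun i => if i ∈ U then μ₁ else μ₂),
      ∀ i, x i ∈ if i ∈ U then A else B := by
    refine Filter.eventually_all.2 fun i => ?_
    refine (Measure.tendsto_eval_ae_ae (i := i)).eventually
      (p := fun y => y ∈ if i ∈ U then A else B) ?_
    split_ifs with hi
    · simpa [hi] using hA
    · simpa [hi] using hB
  filter_upwards [key] with x hx
  convert pairProd_subtype_mul w (· ∈ U) x fun i j hi hj => ?_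
  have h1 := hx i
  have h2 := hx j
  rw [if_pos hi] at h1
  rw [if_neg hj] at h2
  exact hAB _ h1 _ h2

theorem card_notMem (U : Finset (Fin n)) : Fintype.card {i // i ∉ U} = n - U.card := by
  rw [Fintype.card_subtype_compl]; simp

theorem integral_split (h : CrossOne w μ₁ μ₂) (U : Finset (Fin n)) :
    ∫ x, pairProd w x ∂(Measure.pi fun i => if i ∈ U then μ₁ else μ₂) =
      pairIntegral w μ₁ U.card * pairIntegral w μ₂ (n - U.card) := by
  rw [← integral_congr_ae (pairProd_split_ae h U), ← integral_pairProd (Fintype.card_coe U) w μ₁,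
    ← integral_pairProd (card_notMem U) w μ₂, ← integral_prod_mul,
    ← (measurePreserving_split U).integral_comp']
  rfl

theorem integrable_split (h : CrossOne w μ₁ μ₂) (U : Finset (Fin n))
    (h₁ : PairIntegrable w μ₁ U.card) (h₂ : PairIntegrable w μ₂ (n - U.card)) :
    Integrable (pairProd w) (Measure.pi fun i => if i ∈ U then μ₁ else μ₂) := by
  refine Integrable.congr ?_ (pairProd_split_ae h U)
  have := (integrable_pairProd (Fintype.card_coe U) h₁).mul_prod
    (integrable_pairProd (card_notMem U) h₂)
  exact ((measurePreserving_split U).integrable_comp_emb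
    (MeasurableEquiv.measurableEmbedding _)).2 this

theorem PairIntegrable.add (h : CrossOne w μ₁ μ₂) (h₁ : ∀ k ≤ n, PairIntegrable w μ₁ k)
    (h₂ : ∀ k ≤ n, PairIntegrable w μ₂ k) : PairIntegrable w (μ₁ + μ₂) n := by
  rw [PairIntegrable, pi_add_measure]
  refine integrable_finsetSum_measure.2 fun U _ => integrable_split h U (h₁ _ ?_) (h₂ _ ?_)
  · simpa using Finset.card_le_univ U
  · exact Nat.sub_le _ _

/-- The contribution of `U` depends only on its cardinality, whence the binomial coefficients. -/
theorem pairIntegral_add (h : CrossOne w μ₁ μ₂) (h₁ : ∀ k ≤ n, PairIntegrable w μ₁ k)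
    (h₂ : ∀ k ≤ n, PairIntegrable w μ₂ k) :
    pairIntegral w (μ₁ + μ₂) n = ∑ k ∈ Finset.range (n + 1),
      (n.choose k : 𝕜) * (pairIntegral w μ₁ k * pairIntegral w μ₂ (n - k)) := by
  rw [pairIntegral, pi_add_measure, integral_finsetSum_measure]
  · simp_rw [integral_split h]
    rw [Finset.sum_powerset_apply_card
      (fun k => pairIntegral w μ₁ k * pairIntegral w μ₂ (n - k))]
    simp
  · refine fun U _ => integrable_split h U (h₁ _ ?_) (h₂ _ ?_)
    · simpa using Finset.card_le_univ U
    · exact Nat.sub_le _ _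

end Piece

/-! ### Change of scale -/

section Scale

variable {n : ℕ} {w : X → X → 𝕜} {v : Y → Y → 𝕜} {μ : Measure X} [IsFiniteMeasure μ]
  {φ : X → Y} {c : ENNReal} {r : 𝕜} {S : Set X}

theorem pairProd_scale_ae (hS : ∀ᵐ x ∂μ, x ∈ S)
    (h : ∀ x ∈ S, ∀ y ∈ S, v (φ x) (φ y) = r * w x y) :
    (fun x : Fin n → X => pairProd v fun i => φ (x i)) =ᵐ[Measure.pi fun _ => μ]
      fun x => r ^ n.choose 2 * pairProd w x := by
  have key : ∀ᵐ x ∂(Measure.pi fun _ : Fin n => μ), ∀ i, x i ∈ S :=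
    Filter.eventually_all.2 fun i => (Measure.tendsto_eval_ae_ae (i := i)).eventually hS
  filter_upwards [key] with x hx
  exact pairProd_mul_const w v φ r x fun i j _ => h _ (hx i) _ (hx j)

variable [MeasurableSpace Y]

theorem pi_smul_map (hφ : Measurable φ) (hc : c ≠ ⊤) :
    Measure.pi (fun _ : Fin n => c • μ.map φ) =
      c ^ n • (Measure.pi fun _ : Fin n => μ).map fun x i => φ (x i) := by
  have : IsFiniteMeasure (c • μ.map φ) := Measure.smul_finite _ hc
  refine Measure.pi_eq fun s _ => ?_
  rw [Measure.smul_apply, Measure.pi_map_pi fun _ => hφ.aemeasurable, Measure.pi_pi]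
  simp [Finset.prod_mul_distrib]

/-- Each of the `n` points contributes the mass `c`, and each of the `n.choose 2` pairs the factor
`r`. -/
theorem pairIntegral_scale (hφ : Measurable φ) (hv : Measurable (Function.uncurry v))
    (hc : c ≠ ⊤) (hS : ∀ᵐ x ∂μ, x ∈ S) (h : ∀ x ∈ S, ∀ y ∈ S, v (φ x) (φ y) = r * w x y) :
    pairIntegral v (c • μ.map φ) n =
      (c.toReal : 𝕜) ^ n * r ^ n.choose 2 * pairIntegral w μ n := by
  have hm : Measurable fun (x : Fin n → X) i => φ (x i) :=
    measurable_pi_lambda _ fun i => hφ.comp (measurable_pi_apply i)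
  rw [pairIntegral, pi_smul_map hφ hc, integral_smul_measure, integral_map hm.aemeasurable
    (measurable_pairProd hv).aestronglyMeasurable, integral_congr_ae (pairProd_scale_ae hS h),
    integral_const_mul, ENNReal.toReal_pow, RCLike.real_smul_eq_coe_mul, mul_assoc]
  simp [pairIntegral]

theorem PairIntegrable.scale (hφ : Measurable φ) (hv : Measurable (Function.uncurry v))
    (hc : c ≠ ⊤) (hS : ∀ᵐ x ∂μ, x ∈ S) (h : ∀ x ∈ S, ∀ y ∈ S, v (φ x) (φ y) = r * w x y)
    (hw : PairIntegrable w μ n) : PairIntegrable v (c • μ.map φ) n := by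
  have hm : Measurable fun (x : Fin n → X) i => φ (x i) :=
    measurable_pi_lambda _ fun i => hφ.comp (measurable_pi_apply i)
  rw [PairIntegrable, pi_smul_map hφ hc]
  refine Integrable.smul_measure ?_ (ENNReal.pow_ne_top hc)
  rw [integrable_map_measure (measurable_pairProd hv).aestronglyMeasurable hm.aemeasurable]
  exact (hw.const_mul _).congr (pairProd_scale_ae hS h).symm

end Scale

theorem pairIntegral_of_le_one {w : X → X → 𝕜} {μ : Measure X} [IsProbabilityMeasure μ] {n : ℕ}
    (hn : n ≤ 1) : pairIntegral w μ n = 1 := by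
  have : Subsingleton (Fin n) := Fin.subsingleton_iff_le_one.2 hn
  have h : ∀ x : Fin n → X, pairProd w x = 1 := fun x =>
    Finset.prod_eq_one fun i _ => Finset.prod_eq_one fun j _ => by
      rw [Subsingleton.elim i j]; simp
  simp [pairIntegral, h]

theorem pairIntegrable_of_bound {w : X → X → 𝕜} (hw : Measurable (Function.uncurry w)) {C : ℝ}
    (hC : ∀ x y, ‖w x y‖ ≤ C) (μ : Measure X) [IsFiniteMeasure μ] (n : ℕ) :
    PairIntegrable w μ n := by
  -- The maximum with `1` accounts for the index pairs with `i ≥ j`, whose factor is `1`.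
  refine Integrable.of_bound (measurable_pairProd hw).aestronglyMeasurable
    (∏ _i : Fin n, ∏ _j : Fin n, max C 1) (.of_forall fun x => ?_)
  rw [pairProd, norm_prod]
  refine Finset.prod_le_prod (fun _ _ => norm_nonneg _) fun i _ => ?_
  rw [norm_prod]
  refine Finset.prod_le_prod (fun _ _ => norm_nonneg _) fun j _ => ?_
  split_ifs
  · exact (hC _ _).trans (le_max_left _ _)
  · simp

end PairIntegral

/-! ### Iterated binomial convolutions -/

section ConvPow

/-- The `m`-fold binomial convolution of a sequence with itself. -/
def convPow {A : Type*} [CommSemiring A] (u : ℕ → A) : ℕ → ℕ → A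
  | 0, n => if n = 0 then 1 else 0
  | m + 1, n => ∑ k ∈ Finset.range (n + 1), (n.choose k : A) * (convPow u m k * u (n - k))

theorem convPow_zero_right {A : Type*} [CommSemiring A] {u : ℕ → A} (h : u 0 = 1) (m : ℕ) :
    convPow u m 0 = 1 := by
  induction m with
  | zero => simp [convPow]
  | succ m ih => simp [convPow, ih, h]

theorem convPow_congr {A : Type*} [CommSemiring A] {u v : ℕ → A} (m n : ℕ)
    (h : ∀ k ≤ n, u k = v k) : convPow u m n = convPow v m n := by
  induction m generalizing n with
  | zero => rfl
  | succ m ih =>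
    refine Finset.sum_congr rfl fun k hk => ?_
    have hk' : k ≤ n := Nat.lt_succ_iff.1 (Finset.mem_range.1 hk)
    rw [ih k fun j hj => h j (hj.trans hk'), h _ (Nat.sub_le n k)]

/-- Binomial convolution is multiplication of exponential generating functions. -/
theorem convPow_eq_coeff (u : ℕ → ℂ) (m n : ℕ) :
    convPow u m n =
      n.factorial * PowerSeries.coeff n ((PowerSeries.mk fun k => u k / k.factorial) ^ m) := by
  induction m generalizing n with
  | zero => by_cases hn : n = 0 <;> simp [convPow, PowerSeries.coeff_one, hn]
  | succ m ih =>
    rw [pow_succ, PowerSeries.coeff_mul, Finset.Nat.sum_antidiagonal_eq_sum_range_succ_mk,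
      Finset.mul_sum, convPow]
    refine Finset.sum_congr rfl fun k hk => ?_
    have hk' : k ≤ n := Nat.lt_succ_iff.1 (Finset.mem_range.1 hk)
    have hf : ((n - k).factorial : ℂ) ≠ 0 := by exact_mod_cast (n - k).factorial_ne_zero
    rw [ih k, PowerSeries.coeff_mk, ← Nat.choose_mul_factorial_mul_factorial hk']
    push_cast
    field_simp

theorem convPow_nonneg {u : ℕ → ℝ} (m n : ℕ) (hu : ∀ k ≤ n, 0 ≤ u k) : 0 ≤ convPow u m n := by
  induction m generalizing n with
  | zero => simp only [convPow]; split_ifs <;> norm_num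
  | succ m ih =>
    refine Finset.sum_nonneg fun k hk => ?_
    have hk' : k ≤ n := Nat.lt_succ_iff.1 (Finset.mem_range.1 hk)
    exact mul_nonneg (Nat.cast_nonneg _)
      (mul_nonneg (ih k fun j hj => hu j (hj.trans hk')) (hu _ (Nat.sub_le n k)))

theorem convPow_mono {u v : ℕ → ℝ} (m n : ℕ) (hu : ∀ k ≤ n, 0 ≤ u k) (h : ∀ k ≤ n, u k ≤ v k) :
    convPow u m n ≤ convPow v m n := by
  induction m generalizing n with
  | zero => exact le_rfl
  | succ m ih =>
    refine Finset.sum_le_sum fun k hk => ?_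
    have hk' : k ≤ n := Nat.lt_succ_iff.1 (Finset.mem_range.1 hk)
    have h0 := convPow_nonneg m k fun j hj => hu j (hj.trans hk')
    have h1 := ih k (fun j hj => hu j (hj.trans hk')) fun j hj => h j (hj.trans hk')
    exact mul_le_mul_of_nonneg_left (mul_le_mul h1 (h _ (Nat.sub_le n k))
      (hu _ (Nat.sub_le n k)) (h0.trans h1)) (Nat.cast_nonneg _)

/-- The top coefficient enters the convolution power linearly. -/
theorem convPow_le_add {u v : ℕ → ℝ} {n : ℕ} (hn : 1 ≤ n) (h0 : u 0 = 1) (hu : ∀ k ≤ n, 0 ≤ u k)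
    (h : ∀ k < n, u k ≤ v k) (hv : 0 ≤ v n) (m : ℕ) :
    convPow u m n ≤ convPow v m n + m * u n := by
  obtain ⟨n, rfl⟩ : ∃ n', n = n' + 1 := ⟨n - 1, by omega⟩
  have hv' : ∀ k ≤ n + 1, 0 ≤ v k := fun k hk => by
    rcases hk.lt_or_eq with hk' | rfl
    · exact (hu k hk).trans (h k hk')
    · exact hv
  induction m with
  | zero => simp [convPow]
  | succ m ih =>
    -- Only the two extreme terms involve `u (n + 1)`: the last one through the induction
    -- hypothesis, which yields `m` copies, and the first one directly, which yields one more. The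
    -- middle terms are compared factor by factor.
    rw [convPow, convPow, Finset.sum_range_succ _ (n + 1), Finset.sum_range_succ _ (n + 1),
      Finset.sum_range_succ' _ n, Finset.sum_range_succ' _ n]
    have e1 : ∑ k ∈ Finset.range n, ((n + 1).choose (k + 1) : ℝ) *
          (convPow u m (k + 1) * u (n + 1 - (k + 1))) ≤
        ∑ k ∈ Finset.range n, ((n + 1).choose (k + 1) : ℝ) *
          (convPow v m (k + 1) * v (n + 1 - (k + 1))) := by
      refine Finset.sum_le_sum fun k hk => ?_
      have hk' := Finset.mem_range.1 hk
      have a0 := convPow_nonneg m (k + 1) fun j hj => hu j (by omega)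
      have a1 := convPow_mono m (k + 1) (fun j hj => hu j (by omega)) fun j hj => h j (by omega)
      exact mul_le_mul_of_nonneg_left (mul_le_mul a1 (h _ (by omega)) (hu _ (by omega))
        (a0.trans a1)) (Nat.cast_nonneg _)
    have e2 : convPow u m (n + 1) ≤ convPow v m (n + 1) * v 0 + m * u (n + 1) := by
      have hv0 : 1 ≤ v 0 := h0 ▸ h 0 (by omega)
      have hc := convPow_nonneg m (n + 1) hv'
      nlinarith
    have e3 : 0 ≤ convPow v m 0 * v (n + 1) :=
      mul_nonneg (convPow_nonneg m 0 fun j hj => hv' j (by omega)) hv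
    simp only [convPow_zero_right h0, Nat.choose_zero_right, Nat.cast_one, one_mul, Nat.sub_zero,
      Nat.choose_self, Nat.sub_self, h0, mul_one]
    simp only [Nat.add_sub_add_right] at e1 ⊢
    push_cast
    linarith

theorem exists_bound_of_affine_recurrence {u : ℕ → ℝ} {C c : ℝ} (hc0 : 0 ≤ c) (hc : c < 1)
    (h : ∀ M, u (M + 1) ≤ C + c * u M) : ∃ B, ∀ M, u M ≤ B := by
  -- `C / (1 - c)` is the fixed point of `x ↦ C + c x`, and any number above it bounds its own
  -- image.
  refine ⟨max (u 0) (C / (1 - c)), fun M => ?_⟩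
  induction M with
  | zero => exact le_max_left _ _
  | succ M ih =>
    have h1 : C / (1 - c) ≤ max (u 0) (C / (1 - c)) := le_max_right _ _
    rw [div_le_iff₀ (by linarith)] at h1
    nlinarith [h M]

end ConvPow

/-! ### Sums of finitely many measures and self-similar measures -/

section Family

variable {𝕜 : Type*} [RCLike 𝕜] {X α : Type*} [MeasurableSpace X]

/-- The empty family of classes, matching `convPow u 0`: without mass only the empty configuration
survives. -/
theorem pairIntegral_zero_measure (w : X → X → 𝕜) (n : ℕ) :
    PairIntegrable w 0 n ∧ pairIntegral w 0 n = if n = 0 then 1 else 0 := by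
  rcases Nat.eq_zero_or_pos n with rfl | hn
  · constructor
    · rw [PairIntegrable, Measure.pi_of_empty]
      exact integrable_dirac (by simp)
    · rw [pairIntegral, Measure.pi_of_empty]
      simp [pairProd]
  · have : Measure.pi (fun _ : Fin n => (0 : Measure X)) = 0 := by
      rw [← Measure.measure_univ_eq_zero, Measure.pi_univ]
      exact Finset.prod_eq_zero (Finset.mem_univ ⟨0, hn⟩) (by simp)
    constructor
    · rw [PairIntegrable, this]; exact integrable_zero_measure
    · rw [pairIntegral, this]; simp [hn.ne']

theorem ae_finsetSum_measure {s : Finset α} {μ : α → Measure X} {p : X → Prop}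
    (h : ∀ a ∈ s, ∀ᵐ x ∂μ a, p x) : ∀ᵐ x ∂∑ a ∈ s, μ a, p x := by
  rw [ae_iff, Measure.finsetSum_apply]
  exact Finset.sum_eq_zero fun a ha => h a ha

/-- The measures are added one at a time; the union of the carriers already treated interacts
trivially with the new one, so each addition is one binomial convolution. -/
theorem pairIntegral_finsetSum {w : X → X → 𝕜} {μ : α → Measure X} [∀ a, IsFiniteMeasure (μ a)]
    {T : α → Set X} {u : ℕ → 𝕜} {N : ℕ} (s : Finset α) (hT : ∀ a, ∀ᵐ x ∂μ a, x ∈ T a)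
    (hw : ∀ a b, a ≠ b → ∀ x ∈ T a, ∀ y ∈ T b, w x y = 1)
    (hi : ∀ a, ∀ k ≤ N, PairIntegrable w (μ a) k)
    (hu : ∀ a, ∀ k ≤ N, pairIntegral w (μ a) k = u k) :
    ∀ n ≤ N, PairIntegrable w (∑ a ∈ s, μ a) n ∧
      pairIntegral w (∑ a ∈ s, μ a) n = convPow u s.card n := by
  classical
  induction s using Finset.induction_on with
  | empty => intro n _; simpa [convPow] using pairIntegral_zero_measure w n
  | insert a s ha ih =>
    intro n hn
    have hc : CrossOne w (∑ a ∈ s, μ a) (μ a) := by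
      refine ⟨⋃ b ∈ s, T b, T a, ae_finsetSum_measure fun b hb => ?_, hT a, ?_⟩
      · filter_upwards [hT b] with x hx
        exact mem_biUnion hb hx
      · intro x hx y hy
        obtain ⟨b, hb, hx⟩ := mem_iUnion₂.1 hx
        have hba : b ≠ a := by rintro rfl; exact ha hb
        exact ⟨hw b a hba x hx y hy, hw a b hba.symm y hy x hx⟩
    rw [Finset.sum_insert ha, add_comm, Finset.card_insert_of_notMem ha]
    have h1 : ∀ k ≤ n, PairIntegrable w (∑ a ∈ s, μ a) k := fun k hk => (ih k (hk.trans hn)).1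
    have h2 : ∀ k ≤ n, PairIntegrable w (μ a) k := fun k hk => hi a k (hk.trans hn)
    refine ⟨PairIntegrable.add hc h1 h2, ?_⟩
    rw [pairIntegral_add hc h1 h2, convPow]
    refine Finset.sum_congr rfl fun k hk => ?_
    have hk' : k ≤ n := Nat.lt_succ_iff.1 (Finset.mem_range.1 hk)
    rw [(ih k (hk'.trans hn)).2, hu a (n - k) ((Nat.sub_le n k).trans hn)]

/-- A probability measure `μ` carried by `S` which is the average of its images under the maps
`φ a`, these images being carried by the sets `T a`. -/
structure IsSelfSimilar [Fintype α] (μ : Measure X) (S : Set X) (φ : α → X → X) (T : α → Set X) :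
    Prop where
  isProbabilityMeasure : IsProbabilityMeasure μ
  nonempty : Nonempty α
  measurable : ∀ a, Measurable (φ a)
  measurableSet : ∀ a, MeasurableSet (T a)
  ae_mem : ∀ᵐ x ∂μ, x ∈ S
  mapsTo : ∀ a, ∀ x ∈ S, φ a x ∈ T a
  eq_sum : μ = ∑ a, (Fintype.card α : ENNReal)⁻¹ • μ.map (φ a)

variable [Fintype α] {μ : Measure X} {S : Set X} {φ : α → X → X} {T : α → Set X}

/-- The weights `w` and `v` are kept apart because rescaling a truncated weight changes its
truncation level. For the exact weight `|x - y|^β` they coincide. -/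
theorem IsSelfSimilar.pairIntegral_eq (h : IsSelfSimilar μ S φ T) {w v : X → X → 𝕜} {r : 𝕜}
    {N : ℕ} (hv : Measurable (Function.uncurry v))
    (hr : ∀ a, ∀ x ∈ S, ∀ y ∈ S, v (φ a x) (φ a y) = r * w x y)
    (h1 : ∀ a b, a ≠ b → ∀ x ∈ T a, ∀ y ∈ T b, v x y = 1)
    (hi : ∀ k ≤ N, PairIntegrable w μ k) :
    PairIntegrable v μ N ∧ pairIntegral v μ N = convPow
      (fun k => ((Fintype.card α : 𝕜)⁻¹) ^ k * r ^ k.choose 2 * pairIntegral w μ k)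
      (Fintype.card α) N := by
  have := h.isProbabilityMeasure
  have := h.nonempty
  have hc : (Fintype.card α : ENNReal)⁻¹ ≠ ⊤ := by simp
  have : ∀ a, IsFiniteMeasure ((Fintype.card α : ENNReal)⁻¹ • μ.map (φ a)) :=
    fun a => Measure.smul_finite _ hc
  have hT : ∀ a, ∀ᵐ x ∂((Fintype.card α : ENNReal)⁻¹ • μ.map (φ a)), x ∈ T a := by
    intro a
    refine Measure.ae_smul_measure ?_ _
    refine (ae_map_iff (p := fun x => x ∈ T a) (h.measurable a).aemeasurable
      (h.measurableSet a)).2 ?_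
    filter_upwards [h.ae_mem] with x hx
    exact h.mapsTo a x hx
  have key := pairIntegral_finsetSum (N := N) (u := fun k => ((Fintype.card α : 𝕜)⁻¹) ^ k *
      r ^ k.choose 2 * pairIntegral w μ k) Finset.univ hT h1
    (fun a k hk => (hi k hk).scale (h.measurable a) hv hc h.ae_mem (hr a))
    (fun a k hk => by
      rw [pairIntegral_scale (h.measurable a) hv hc h.ae_mem (hr a)]
      simp) N le_rfl
  rw [← h.eq_sum] at key
  simpa using key

/-- Partition functions stay bounded under iterated rescaling when the coefficient of the top term
is less than `1`. -/
theorem IsSelfSimilar.exists_bound (h : IsSelfSimilar μ S φ T) {w : ℕ → X → X → ℝ} {r : ℝ}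
    {N : ℕ} (hw : ∀ M, Measurable (Function.uncurry (w M)))
    (hw0 : ∀ M x y, 0 ≤ w M x y) (hr0 : 0 ≤ r)
    (hi : ∀ M k, PairIntegrable (w M) μ k)
    (hr : ∀ M a, ∀ x ∈ S, ∀ y ∈ S, w (M + 1) (φ a x) (φ a y) = r * w M x y)
    (h1 : ∀ M a b, a ≠ b → ∀ x ∈ T a, ∀ y ∈ T b, w M x y = 1)
    (hN : ∀ n, 2 ≤ n → n ≤ N →
      (Fintype.card α : ℝ) * ((Fintype.card α : ℝ)⁻¹ ^ n * r ^ n.choose 2) < 1) :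
    ∀ n ≤ N, ∃ B, ∀ M, pairIntegral (w M) μ n ≤ B := by
  have := h.isProbabilityMeasure
  have hnn : ∀ M k, 0 ≤ pairIntegral (w M) μ k := fun M k =>
    integral_nonneg fun x => Finset.prod_nonneg fun i _ => Finset.prod_nonneg fun j _ => by
      split_ifs
      · exact hw0 M _ _
      · exact zero_le_one
  intro n
  induction n using Nat.strong_induction_on with
  | _ n ih =>
    intro hn
    by_cases hn2 : n ≤ 1
    · exact ⟨1, fun M => (pairIntegral_of_le_one hn2).le⟩
    push Not at hn2
    choose! B hB using fun k (hk : k < n) => ih k hk (hk.le.trans hn)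
    set q : ℝ := (Fintype.card α : ℝ) with hq
    have hq0 : 0 ≤ q := Nat.cast_nonneg _
    have hκ : ∀ k, 0 ≤ q⁻¹ ^ k * r ^ k.choose 2 := fun k => by positivity
    -- The bounds already known below `n`, with `0` at `n`: this puts all lower terms into the
    -- constant `C` and leaves the unknown integral of `n` points with the coefficient `c`.
    set v : ℕ → ℝ := fun k => if k < n then q⁻¹ ^ k * r ^ k.choose 2 * B k else 0 with hvdef
    refine exists_bound_of_affine_recurrence (C := convPow v (Fintype.card α) n)
      (c := q * (q⁻¹ ^ n * r ^ n.choose 2)) (mul_nonneg hq0 (hκ n)) (hN n hn2 hn) fun M => ?_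
    rw [(h.pairIntegral_eq (hw (M + 1)) (hr M) (h1 (M + 1)) fun k _ => hi M k).2]
    refine (convPow_le_add (v := v) (by omega) ?_ ?_ ?_ ?_ _).trans_eq ?_
    · simp [pairIntegral_of_le_one]
    · exact fun k _ => mul_nonneg (hκ k) (hnn M k)
    · intro k hk
      simp only [hvdef, if_pos hk]
      exact mul_le_mul_of_nonneg_left (hB k hk M) (hκ k)
    · simp [hvdef]
    · ring

end Family

/-! ### The functions `F_N` -/

section Recurrence

/-- The quotient `sinh (t a / 2) / sinh (t b / 2)` with its limit `a / b` at `t = 0`. -/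
noncomputable def sinhQuot (a b : ℂ) (t : ℝ) : ℂ :=
  if t = 0 then a / b else Complex.sinh ((t : ℂ) / 2 * a) / Complex.sinh ((t : ℂ) / 2 * b)

theorem F_of_le_one {N : ℕ} (hN : N ≤ 1) (t : ℝ) (β : ℂ) : F N t β = 1 := by
  rw [F, if_pos hN]

theorem F_of_two_le {N : ℕ} (hN : 2 ≤ N) (t : ℝ) (β : ℂ) :
    F N t β = ∑ k ∈ Finset.Icc 1 (N - 1), (k : ℂ) / N *
      sinhQuot (expo N β * (1 - 2 * (k : ℂ) / N) + 1) (expo N β - 1) t *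
        F (N - k) t β * F k t β := by
  rw [F, if_neg (by omega)]
  exact Finset.sum_coe_sort (Finset.Icc 1 (N - 1)) fun k => (k : ℂ) / N *
      sinhQuot (expo N β * (1 - 2 * (k : ℂ) / N) + 1) (expo N β - 1) t *
        F (N - k) t β * F k t β

theorem sinhQuot_neg (a b : ℂ) (t : ℝ) : sinhQuot a b (-t) = sinhQuot a b t := by
  simp only [sinhQuot, neg_eq_zero]
  split_ifs
  · rfl
  · push_cast
    rw [neg_div, neg_mul, neg_mul, Complex.sinh_neg, Complex.sinh_neg, neg_div_neg_eq]

/-- Replacing `q` by `1/q` changes the sign of `t = log q`, so both functional equations rest on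
this symmetry. -/
theorem F_neg (N : ℕ) (t : ℝ) (β : ℂ) : F N (-t) β = F N t β := by
  induction N using Nat.strong_induction_on with
  | _ N ih =>
    rcases Nat.lt_or_ge N 2 with hN | hN
    · rw [F_of_le_one (by omega), F_of_le_one (by omega)]
    · rw [F_of_two_le hN, F_of_two_le hN]
      refine Finset.sum_congr rfl fun k hk => ?_
      have := Finset.mem_Icc.1 hk
      rw [sinhQuot_neg, ih k (by omega), ih (N - k) (by omega)]

/-- The hypothesis for `N` points passes to the smaller configurations met in the recurrence. -/
theorem neg_two_div_lt_of_le {N n : ℕ} {σ : ℝ} (hn : 1 ≤ n) (h : n ≤ N)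
    (hσ : -2 / (N : ℝ) < σ) : -2 / (n : ℝ) < σ := by
  refine lt_of_le_of_lt ?_ hσ
  have h1 : (0 : ℝ) < n := by exact_mod_cast hn
  have h2 : (n : ℝ) ≤ N := by exact_mod_cast h
  rw [neg_div, neg_div]
  exact neg_le_neg (div_le_div_of_nonneg_left (by norm_num) h1 h2)

/-- The origin of the threshold: at `σ = -2/N` the right side equals `N - (N - 1) = 1`. -/
theorem one_lt_add_choose_mul {N : ℕ} (hN : 2 ≤ N) {σ : ℝ} (hσ : -2 / (N : ℝ) < σ) :
    1 < (N : ℝ) + (N.choose 2 : ℝ) * σ := by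
  have h1 : (2 : ℝ) ≤ N := by exact_mod_cast hN
  rw [Nat.cast_choose_two]
  rw [div_lt_iff₀ (by linarith)] at hσ
  nlinarith

theorem expo_sub_one_re_pos {N : ℕ} (hN : 2 ≤ N) {β : ℂ} (hβ : -2 / (N : ℝ) < β.re) :
    0 < (expo N β - 1).re := by
  have := one_lt_add_choose_mul hN hβ
  have h : (expo N β - 1).re = (N : ℝ) + (N.choose 2 : ℝ) * β.re - 1 := by
    simp [expo, Complex.mul_re]
  linarith

/-- This explains the factor `1 - 2k/N` in the formulas: it comes from the difference of the
exponents of the two groups of points. -/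
theorem expo_sub {N k : ℕ} (hN : N ≠ 0) (hk : k ≤ N) (β : ℂ) :
    expo (N - k) β - expo k β = expo N β * (1 - 2 * (k : ℂ) / N) := by
  have : (N : ℂ) ≠ 0 := by exact_mod_cast hN
  simp only [expo, Nat.cast_choose_two, Nat.cast_sub hk]
  field_simp
  ring

/-- All zeros of `sinh` are purely imaginary, whereas `t b / 2` has nonzero real part. -/
theorem sinh_half_ne_zero {b : ℂ} (hb : 0 < b.re) {t : ℝ} (ht : t ≠ 0) :
    Complex.sinh ((t : ℂ) / 2 * b) ≠ 0 := by
  intro h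
  have h2 : Complex.exp ((t : ℂ) * b) = 1 := by
    rw [Complex.sinh, div_eq_zero_iff, or_iff_left (by norm_num), sub_eq_zero] at h
    calc Complex.exp ((t : ℂ) * b) = Complex.exp (t / 2 * b) * Complex.exp (t / 2 * b) := by
          rw [← Complex.exp_add]; congr 1; ring
      _ = 1 := by
          nth_rewrite 1 [h]
          rw [← Complex.exp_add]; simp
  have h3 := congrArg (fun z : ℂ => ‖z‖) h2
  simp only [Complex.norm_exp, norm_one, Real.exp_eq_one_iff] at h3
  simp only [Complex.mul_re, Complex.ofReal_re, Complex.ofReal_im, zero_mul, sub_zero] at h3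
  exact (mul_ne_zero ht hb.ne') h3

/-- Write `sinh z = z S(z)` with `S` entire and `S(0) = 1`. The factors `t` cancel and the quotient
becomes `(a/b) S(ta/2) / S(tb/2)`, which also has the prescribed value at `t = 0`; the denominator
never vanishes. -/
theorem contDiff_sinhQuot (a : ℂ) {b : ℂ} (hb : 0 < b.re) : ContDiff ℝ ∞ (sinhQuot a b) := by
  set S : ℂ → ℂ := dslope Complex.sinh 0 with hS
  have hSd : Differentiable ℂ S := by
    rw [← differentiableOn_univ]
    exact (Complex.differentiableOn_dslope Filter.univ_mem).2
      Complex.differentiable_sinh.differentiableOn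
  have hSc : ContDiff ℝ ∞ S := (hSd.contDiff (n := ∞)).restrict_scalars ℝ
  have hmul : ∀ z : ℂ, Complex.sinh z = z * S z := fun z => by
    have := sub_smul_dslope Complex.sinh 0 z
    simpa using this.symm
  have hS0 : S 0 = 1 := by
    rw [hS, dslope_same, Complex.deriv_sinh, Complex.cosh_zero]
  have hb0 : b ≠ 0 := by rintro rfl; simp at hb
  have hne : ∀ t : ℝ, S ((t : ℂ) / 2 * b) ≠ 0 := by
    intro t
    by_cases ht : t = 0
    · simp [ht, hS0]
    · exact fun h => sinh_half_ne_zero hb ht (by rw [hmul, h, mul_zero])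
  have heq : sinhQuot a b = fun t : ℝ =>
      a / b * (S ((t : ℂ) / 2 * a) * (S ((t : ℂ) / 2 * b))⁻¹) := by
    funext t
    unfold sinhQuot
    split_ifs with ht
    · simp [ht, hS0]
    · have ht' : (t : ℂ) ≠ 0 := by exact_mod_cast ht
      have := hne t
      rw [hmul, hmul]
      field_simp
  rw [heq]
  have hlin : ∀ c : ℂ, ContDiff ℝ ∞ fun t : ℝ => (t : ℂ) / 2 * c := fun c =>
    (Complex.ofRealCLM.contDiff.div_const 2).mul contDiff_const
  exact contDiff_const.mul ((hSc.comp (hlin a)).mul ((hSc.comp (hlin b)).inv hne))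

theorem contDiff_F {N : ℕ} {β : ℂ} (hβ : -2 / (N : ℝ) < β.re) {n : ℕ} (hn : n ≤ N) :
    ContDiff ℝ ∞ fun t : ℝ => F n t β := by
  induction n using Nat.strong_induction_on with
  | _ n ih =>
    rcases Nat.lt_or_ge n 2 with h | h
    · simp_rw [F_of_le_one (show n ≤ 1 by omega)]
      exact contDiff_const
    · simp_rw [F_of_two_le h]
      refine ContDiff.sum fun k hk => ?_
      have := Finset.mem_Icc.1 hk
      have hb := expo_sub_one_re_pos h (neg_two_div_lt_of_le (by omega) hn hβ)
      exact ((contDiff_const.mul (contDiff_sinhQuot _ hb)).mul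
        (ih _ (by omega) (by omega))).mul (ih _ (by omega) (by omega))

theorem coeff_X_mul_derivative (P : PowerSeries ℂ) (n : ℕ) :
    PowerSeries.coeff n (PowerSeries.X * PowerSeries.derivative ℂ P) =
      n * PowerSeries.coeff n P := by
  cases n with
  | zero => simp
  | succ n =>
    rw [mul_comm, PowerSeries.coeff_succ_mul_X, PowerSeries.coeff_derivative]
    push_cast
    ring

/-- The logarithmic derivative of `A = G ^ q`, in coefficients. -/
theorem sum_mul_coeff_eq {z g : ℕ → ℂ} {q n : ℕ}
    (h : ∀ k ≤ n, z k = PowerSeries.coeff k (PowerSeries.mk g ^ q)) :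
    ∑ k ∈ Finset.range (n + 1), (k : ℂ) * z k * g (n - k) =
      q * ∑ k ∈ Finset.range (n + 1), (k : ℂ) * g k * z (n - k) := by
  set G := PowerSeries.mk g with hG
  -- With `θ = X d/dX`, the identity `θA / A = q θG / G` is cleared of denominators, so no
  -- invertibility is required.
  have key : PowerSeries.X * PowerSeries.derivative ℂ (G ^ q) * G =
      q • (PowerSeries.X * PowerSeries.derivative ℂ G * G ^ q) := by
    rw [Derivation.leibniz_pow]
    cases q with
    | zero => simp
    | succ q =>
      simp only [Nat.add_sub_cancel, smul_eq_mul, nsmul_eq_mul]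
      ring
  have := congrArg (PowerSeries.coeff n) key
  rw [map_nsmul, PowerSeries.coeff_mul, PowerSeries.coeff_mul,
    Finset.Nat.sum_antidiagonal_eq_sum_range_succ_mk,
    Finset.Nat.sum_antidiagonal_eq_sum_range_succ_mk, nsmul_eq_mul] at this
  simp only [coeff_X_mul_derivative] at this
  refine Eq.trans ?_ (this.trans ?_)
  · refine Finset.sum_congr rfl fun k hk => ?_
    rw [h k (Nat.lt_succ_iff.1 (Finset.mem_range.1 hk)), hG, PowerSeries.coeff_mk]
  · congr 1
    refine Finset.sum_congr rfl fun k hk => ?_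
    rw [h _ (Nat.sub_le n k), hG, PowerSeries.coeff_mk]

theorem two_sinh_half (t s : ℂ) :
    2 * Complex.sinh (t / 2 * s) = Complex.exp (t / 2 * s) - Complex.exp (-(t / 2 * s)) := by
  rw [Complex.sinh]; ring

/-- A sequence `Z` satisfying the self-similarity relation for partition functions is given by the
functions `F_n`. -/
theorem eq_factorial_mul_exp_mul_F {q N : ℕ} {β : ℂ} (hq : 2 ≤ q) (hβ : -2 / (N : ℝ) < β.re)
    {t : ℝ} (ht : t = Real.log q) {Z : ℕ → ℂ} (hZ1 : ∀ n ≤ 1, Z n = 1)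
    (hZ : ∀ n ≤ N, Z n = convPow (fun k => Complex.exp (-(t * expo k β)) * Z k) q n)
    {n : ℕ} (hn : n ≤ N) :
    Z n = n.factorial * Complex.exp (t / 2 * (n.choose 2 * β)) * F n t β := by
  have hqt : (q : ℂ) = Complex.exp t := by
    rw [ht, ← Complex.ofReal_exp, Real.exp_log (by exact_mod_cast (by omega : 0 < q))]
    simp
  have ht0 : t ≠ 0 := by
    rw [ht]
    exact (Real.log_pos (by exact_mod_cast (by omega : 1 < q))).ne'
  induction n using Nat.strong_induction_on with
  | _ n ih =>
    rcases Nat.lt_or_ge n 2 with h | h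
    · rw [hZ1 n (by omega), F_of_le_one (by omega), Nat.choose_eq_zero_of_lt h]
      have : n = 0 ∨ n = 1 := by omega
      rcases this with rfl | rfl <;> simp
    have hfac : ∀ k : ℕ, (k.factorial : ℂ) ≠ 0 := fun k => by exact_mod_cast k.factorial_ne_zero
    -- The coefficients of the exponential generating function, followed by the weights `E k =
    -- q^(-expo k β)` of `k` points in one residue class.
    set z : ℕ → ℂ := fun k => Z k / k.factorial with hz
    set E : ℕ → ℂ := fun k => Complex.exp (-(t * expo k β)) with hE
    have hrec := sum_mul_coeff_eq (z := z) (g := fun k => E k * z k) (q := q) (n := n)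
      (fun k hk => by
        have := hZ k (hk.trans hn)
        rw [convPow_eq_coeff] at this
        simp only [hz]
        nth_rewrite 1 [this]
        rw [mul_div_cancel_left₀ _ (hfac k)]
        simp only [hE, mul_div_assoc])
    have hz0 : z 0 = 1 := by simp [hz, hZ1]
    have hzF : ∀ k < n, z k = Complex.exp (t / 2 * (k.choose 2 * β)) * F k t β := fun k hk => by
      simp only [hz]
      rw [ih k hk (by omega)]
      have := hfac k
      field_simp
    have hn0 : (n : ℂ) ≠ 0 := by exact_mod_cast (by omega : n ≠ 0)
    have hE0 : E 0 = 1 := by simp [hE, expo]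
    have hsplit : ∀ f : ℕ → ℂ, f 0 = 0 →
        ∑ k ∈ Finset.range (n + 1), f k = (∑ k ∈ Finset.Icc 1 (n - 1), f k) + f n := by
      intro f hf
      rw [Finset.sum_range_succ, Finset.range_eq_Ico,
        Finset.sum_eq_sum_Ico_succ_bot (by omega), hf, zero_add]
      congr 2
    -- The terms `k = 0` vanish by the factor `k`, and `z n` now occurs only in the terms `k = n`.
    rw [hsplit _ (by simp), hsplit _ (by simp)] at hrec
    simp only [Nat.sub_self, hz0, hE0, mul_one] at hrec
    have hb := sinh_half_ne_zero (expo_sub_one_re_pos h (neg_two_div_lt_of_le (by omega) hn hβ))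
      ht0
    -- `P = q^((1-n)/2)` is the half-power common to all terms; once it is taken out, each
    -- difference of exponentials becomes a hyperbolic sine.
    set P : ℂ := Complex.exp (t / 2 * (1 - n)) with hP
    have hP0 : P ≠ 0 := Complex.exp_ne_zero _
    -- the coefficient of `z n`
    have hleft : 1 - q * E n = Complex.exp (-(t / 2 * (n.choose 2 * β))) * P *
        (2 * Complex.sinh (t / 2 * (expo n β - 1))) := by
      have h1 : Complex.exp (-(t / 2 * (n.choose 2 * β))) * P *
          Complex.exp (t / 2 * (expo n β - 1)) = 1 := by
        rw [hP, ← Complex.exp_add, ← Complex.exp_add, Complex.exp_eq_one_iff]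
        exact ⟨0, by simp only [expo]; push_cast; ring⟩
      have h2 : Complex.exp (-(t / 2 * (n.choose 2 * β))) * P *
          Complex.exp (-(t / 2 * (expo n β - 1))) = q * E n := by
        rw [hP, hE, hqt, ← Complex.exp_add, ← Complex.exp_add, ← Complex.exp_add]
        congr 1
        simp only [expo]
        ring
      rw [two_sinh_half, mul_sub, h1, h2]
    -- The `k`-th terms of the two sides share `z k * z (n - k)`, and their exponentials are `P e^x`
    -- and `P e^(-x)` with `x = t/2 (expo (n-k) β - expo k β + 1)`.
    have hterm : ∀ k ∈ Finset.Icc 1 (n - 1),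
        q * (k * (E k * z k) * z (n - k)) - k * z k * (E (n - k) * z (n - k)) =
        P * (2 * Complex.sinh (t / 2 * (expo n β * (1 - 2 * (k : ℂ) / n) + 1))) *
          (k * F (n - k) t β * F k t β) := by
      intro k hk
      have hk' := Finset.mem_Icc.1 hk
      have hkn : k ≤ n := by omega
      rw [hzF k (by omega), hzF (n - k) (by omega), two_sinh_half, ← expo_sub (by omega) hkn]
      have h1 : q * E k * Complex.exp (t / 2 * (k.choose 2 * β)) *
          Complex.exp (t / 2 * ((n - k).choose 2 * β)) =
          P * Complex.exp (t / 2 * (expo (n - k) β - expo k β + 1)) := by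
        rw [hqt, hP, hE, ← Complex.exp_add, ← Complex.exp_add, ← Complex.exp_add,
          ← Complex.exp_add]
        congr 1
        simp only [expo, Nat.cast_sub hkn]
        ring
      have h2 : E (n - k) * Complex.exp (t / 2 * (k.choose 2 * β)) *
          Complex.exp (t / 2 * ((n - k).choose 2 * β)) =
          P * Complex.exp (-(t / 2 * (expo (n - k) β - expo k β + 1))) := by
        rw [hP, hE, ← Complex.exp_add, ← Complex.exp_add, ← Complex.exp_add]
        congr 1
        simp only [expo, Nat.cast_sub hkn]
        ring
      linear_combination (k * F (n - k) t β * F k t β) * (h1 - h2)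
    have hsum : n * z n * (1 - q * E n) = P * 2 *
        ∑ k ∈ Finset.Icc 1 (n - 1),
          Complex.sinh (t / 2 * (expo n β * (1 - 2 * (k : ℂ) / n) + 1)) *
            (k * F (n - k) t β * F k t β) := by
      have : ∑ k ∈ Finset.Icc 1 (n - 1), (q * (k * (E k * z k) * z (n - k)) -
          k * z k * (E (n - k) * z (n - k))) = n * z n * (1 - q * E n) := by
        rw [Finset.sum_sub_distrib, ← Finset.mul_sum]
        linear_combination -hrec
      rw [← this, Finset.sum_congr rfl hterm, Finset.mul_sum]
      exact Finset.sum_congr rfl fun k _ => by ring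
    have hF : F n t β * (n * Complex.sinh (t / 2 * (expo n β - 1))) =
        ∑ k ∈ Finset.Icc 1 (n - 1),
          Complex.sinh (t / 2 * (expo n β * (1 - 2 * (k : ℂ) / n) + 1)) *
            (k * F (n - k) t β * F k t β) := by
      rw [F_of_two_le h, Finset.sum_mul]
      refine Finset.sum_congr rfl fun k _ => ?_
      rw [sinhQuot, if_neg ht0]
      generalize Complex.sinh (t / 2 * (expo n β - 1)) = b at hb ⊢
      generalize Complex.sinh _ = a
      field_simp
    rw [hleft, ← hF] at hsum
    have hcan : z n * Complex.exp (-(t / 2 * (n.choose 2 * β))) = F n t β := by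
      have h0 : P * 2 * (n * Complex.sinh (t / 2 * (expo n β - 1))) ≠ 0 :=
        mul_ne_zero (mul_ne_zero hP0 two_ne_zero) (mul_ne_zero hn0 hb)
      refine mul_right_cancel₀ h0 ?_
      linear_combination hsum
    rw [← hcan, Complex.exp_neg]
    simp only [hz]
    have := Complex.exp_ne_zero (t / 2 * (n.choose 2 * β))
    have := hfac n
    field_simp

end Recurrence

/-! ### Haar measure on the integers -/

section Haar

theorem secondCountable_of_locallyCompact (K : Type*) [NontriviallyNormedField K]
    [LocallyCompactSpace K] : SecondCountableTopology K := by
  have : ProperSpace K := .of_nontriviallyNormedField_of_weaklyLocallyCompactSpace K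
  infer_instance

variable {K : Type*} [NontriviallyNormedField K] [IsUltrametricDist K]

theorem HasCanonicalNorm.exists_uniformizer (hK : HasCanonicalNorm K) :
    2 ≤ residueCard K ∧ ∃ π : K, ‖π‖ = (residueCard K : ℝ)⁻¹ ∧
      ∀ x : K, ‖x‖ < 1 → ∃ z : K, ‖z‖ ≤ 1 ∧ x = π * z := by
  obtain ⟨π, hπ, hn⟩ := hK
  have hdiv : ∀ x : K, ‖x‖ < 1 → ∃ z : K, ‖z‖ ≤ 1 ∧ x = π * z := by
    intro x hx
    have h1 : (⟨x, hx.le⟩ : integers K) ∈ maxIdeal K := hx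
    rw [hπ, Ideal.mem_span_singleton] at h1
    obtain ⟨z, hz⟩ := h1
    exact ⟨z, z.2, congrArg Subtype.val hz⟩
  refine ⟨?_, π, hn, hdiv⟩
  -- `Nat.card` is `0` on an infinite type. In that case `π = 0`, so the open unit ball would be
  -- trivial, contrary to the norm being nontrivial. Finiteness of the residue field thus follows
  -- from the canonical norm.
  have h0 : residueCard K ≠ 0 := by
    intro h
    rw [h, Nat.cast_zero, inv_zero, norm_eq_zero] at hn
    obtain ⟨x, hx0, hx⟩ := NormedField.exists_norm_lt_one K
    obtain ⟨z, -, rfl⟩ := hdiv x hx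
    simp [hn] at hx0
  have h1 : residueCard K ≠ 1 := by
    intro h
    have := (Nat.card_eq_one_iff_unique.1 h).1
    rw [Ideal.Quotient.subsingleton_iff] at this
    have h2 : (1 : integers K) ∈ maxIdeal K := by rw [this]; trivial
    have h3 : ‖((1 : integers K) : K)‖ < 1 := h2
    simp at h3
  omega

theorem isOpen_integers : IsOpen (integers K : Set K) := by
  have : (integers K : Set K) = Metric.closedBall 0 1 := by
    ext x; simp [integers]
  rw [this]
  exact IsUltrametricDist.isOpen_closedBall _ one_ne_zero

/-- The affine map of the integers onto the residue class `a`. -/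
noncomputable def residueMap (π : K) (a : integers K ⧸ maxIdeal K) (x : K) : K :=
  (Quotient.out a : integers K) + π * x

/-- A residue class, as a subset of the field. -/
def residueClass (a : integers K ⧸ maxIdeal K) : Set K :=
  {x | ‖x - (Quotient.out a : integers K)‖ < 1}

/-- The two representatives differ by an element of norm `1`. Moving within the classes changes this
difference by something of norm less than `1`, which does not affect its norm in an ultrametric
field. -/
theorem norm_sub_eq_one_of_residueClass {a b : integers K ⧸ maxIdeal K} (hab : a ≠ b) {x y : K}
    (hx : x ∈ residueClass a) (hy : y ∈ residueClass b) : ‖x - y‖ = 1 := by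
  set u : integers K := Quotient.out a with hu
  set v : integers K := Quotient.out b with hv
  have huv : ‖(u : K) - v‖ = 1 := by
    refine le_antisymm (u - v).2 (not_lt.1 fun h => hab ?_)
    have h1 : Ideal.Quotient.mk (maxIdeal K) u = Ideal.Quotient.mk (maxIdeal K) v :=
      Ideal.Quotient.eq.2 (show u - v ∈ maxIdeal K from h)
    have ha : Ideal.Quotient.mk (maxIdeal K) u = a := Quotient.out_eq a
    have hb : Ideal.Quotient.mk (maxIdeal K) v = b := Quotient.out_eq b
    rw [← ha, ← hb, h1]
  have hs : ‖(x - u) - (y - v)‖ < 1 := by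
    rw [sub_eq_add_neg]
    refine (IsUltrametricDist.norm_add_le_max _ _).trans_lt (max_lt hx ?_)
    rw [norm_neg]
    exact hy
  have : x - y = ((x - u) - (y - v)) + (u - v) := by ring
  rw [this, IsUltrametricDist.norm_add_eq_max_of_norm_ne_norm (by rw [huv]; exact hs.ne), huv,
    max_eq_right hs.le]

theorem norm_mul_lt_one {π : K} (hπ : ‖π‖ < 1) {x : K} (hx : x ∈ integers K) : ‖π * x‖ < 1 := by
  rw [norm_mul]
  have hx' : ‖x‖ ≤ 1 := hx
  exact (mul_le_of_le_one_right (norm_nonneg _) hx').trans_lt hπ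

theorem residueMap_mem_residueClass {π : K} (hπ : ‖π‖ < 1) {x : K} (hx : x ∈ integers K)
    (a : integers K ⧸ maxIdeal K) : residueMap π a x ∈ residueClass a := by
  simpa [residueMap, residueClass] using norm_mul_lt_one hπ hx

variable [MeasurableSpace K] [BorelSpace K]

theorem measurable_residueMap (π : K) (a : integers K ⧸ maxIdeal K) : Measurable (residueMap π a) := by
  have : Continuous (residueMap π a) := by unfold residueMap; fun_prop
  exact this.measurable

theorem measurableSet_residueClass (a : integers K ⧸ maxIdeal K) :
    MeasurableSet (residueClass a) := by
  have : IsOpen (residueClass a) := isOpen_lt (by fun_prop) continuous_const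
  exact this.measurableSet

theorem measurableSet_integers : MeasurableSet (integers K : Set K) :=
  isOpen_integers.measurableSet

/-- Invariance of a measure under translations by integers. -/
def IsIntegerInvariant (m : Measure K) : Prop :=
  ∀ y ∈ integers K, m.map (fun x => x + y) = m

variable [LocallyCompactSpace K]

/-- Probability measures on the integers that are invariant under translation by integers
coincide. -/
theorem IsIntegerInvariant.unique {m₁ m₂ : Measure K} [IsProbabilityMeasure m₁]
    [IsProbabilityMeasure m₂] (h₁ : IsIntegerInvariant m₁) (h₂ : IsIntegerInvariant m₂)
    (hs₁ : ∀ᵐ x ∂m₁, x ∈ integers K) (hs₂ : ∀ᵐ x ∂m₂, x ∈ integers K) : m₁ = m₂ := by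
  have := secondCountable_of_locallyCompact K
  refine Measure.ext fun E hE => ?_
  have key : ∀ {m : Measure K}, IsIntegerInvariant m → ∀ y ∈ integers K,
      ∫⁻ x, E.indicator (fun _ => (1 : ENNReal)) (x + y) ∂m = m E := by
    intro m hm y hy
    rw [← lintegral_map (f := E.indicator fun _ => (1 : ENNReal)) (measurable_const.indicator hE)
      (measurable_add_const y), hm y hy, lintegral_indicator_const hE, one_mul]
  have hmeas : Measurable fun p : K × K => E.indicator (fun _ => (1 : ENNReal)) (p.1 + p.2) :=
    (measurable_const.indicator hE).comp measurable_add
  -- The double integral of the indicator of `x + y ∈ E` is evaluated in both orders; by invariance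
  -- each inner integral is constant.
  calc m₁ E = ∫⁻ _y, m₁ E ∂m₂ := by simp
    _ = ∫⁻ y, ∫⁻ x, E.indicator (fun _ => (1 : ENNReal)) (x + y) ∂m₁ ∂m₂ := by
        refine lintegral_congr_ae ?_
        filter_upwards [hs₂] with y hy
        exact (key h₁ y hy).symm
    _ = ∫⁻ x, ∫⁻ y, E.indicator (fun _ => (1 : ENNReal)) (x + y) ∂m₂ ∂m₁ :=
        lintegral_lintegral_swap (hmeas.comp measurable_swap).aemeasurable
    _ = ∫⁻ _x, m₂ E ∂m₁ := by
        refine lintegral_congr_ae ?_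
        filter_upwards [hs₁] with x hx
        rw [← key h₂ x hx]
        simp_rw [add_comm x]
    _ = m₂ E := by simp

theorem haarOnIntegers_ae_mem : ∀ᵐ x ∂haarOnIntegers K, x ∈ integers K :=
  ae_restrict_mem measurableSet_integers

theorem isProbabilityMeasure_haarOnIntegers : IsProbabilityMeasure (haarOnIntegers K) := by
  have : ProperSpace K := .of_nontriviallyNormedField_of_weaklyLocallyCompactSpace K
  have h0 : (Measure.addHaar : Measure K) (integers K : Set K) ≠ 0 :=
    (isOpen_integers.measure_pos _ ⟨0, (integers K).zero_mem⟩).ne'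
  have hT : (Measure.addHaar : Measure K) (integers K : Set K) ≠ ⊤ := by
    have : (integers K : Set K) = Metric.closedBall 0 1 := by
      ext x; simp [integers]
    rw [this]
    exact (isCompact_closedBall _ _).measure_ne_top
  refine ⟨?_⟩
  rw [haarOnIntegers, Measure.restrict_apply_univ, Measure.smul_apply, smul_eq_mul,
    ENNReal.inv_mul_cancel h0 hT]

theorem isIntegerInvariant_haarOnIntegers : IsIntegerInvariant (haarOnIntegers K) := by
  intro y hy
  refine Measure.ext fun E hE => ?_
  have hpre : (fun x => x + y) ⁻¹' (integers K : Set K) = integers K := by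
    ext x
    exact (integers K).add_mem_cancel_right hy
  rw [Measure.map_apply (measurable_add_const y) hE, haarOnIntegers,
    Measure.restrict_apply (measurable_add_const y hE), Measure.restrict_apply hE,
    Measure.smul_apply, Measure.smul_apply]
  congr 1
  nth_rewrite 1 [← hpre]
  rw [← preimage_inter, measure_preimage_add_right]

theorem eq_haarOnIntegers {m : Measure K} [IsProbabilityMeasure m] (h : IsIntegerInvariant m)
    (hs : ∀ᵐ x ∂m, x ∈ integers K) : m = haarOnIntegers K :=
  have := isProbabilityMeasure_haarOnIntegers (K := K)
  h.unique isIntegerInvariant_haarOnIntegers hs haarOnIntegers_ae_mem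

/-- Translating the image of Haar measure in a residue class. -/
theorem map_add_map_residueMap {π : K}
    (hdiv : ∀ x : K, ‖x‖ < 1 → ∃ z : K, ‖z‖ ≤ 1 ∧ x = π * z) {y : K} (hy : y ∈ integers K) (a : integers K ⧸ maxIdeal K) :
    ((haarOnIntegers K).map (residueMap π a)).map (fun x => x + y) =
      (haarOnIntegers K).map
        (residueMap π (a + Ideal.Quotient.mk (maxIdeal K) ⟨y, hy⟩)) := by
  set b := a + Ideal.Quotient.mk (maxIdeal K) ⟨y, hy⟩ with hb
  set u : integers K := Quotient.out a with hu
  set v : integers K := Quotient.out b with hv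
  have ha' : Ideal.Quotient.mk (maxIdeal K) u = a := Quotient.out_eq a
  have hb' : Ideal.Quotient.mk (maxIdeal K) v = b := Quotient.out_eq b
  have h1 : ‖(u : K) + y - v‖ < 1 := by
    have : u + ⟨y, hy⟩ - v ∈ maxIdeal K := by
      rw [← Ideal.Quotient.eq, map_add, ha', hb']
    exact this
  -- Translation by `y` sends class `a` to class `b`, up to an error between representatives. The
  -- error has the form `π * z`, so precomposing with the translation by `z` absorbs it.
  obtain ⟨z, hz, hzv⟩ := hdiv _ h1
  rw [Measure.map_map (measurable_add_const y) (measurable_residueMap π a)]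
  conv_rhs => rw [← isIntegerInvariant_haarOnIntegers z hz]
  rw [Measure.map_map (measurable_residueMap π b) (measurable_add_const z)]
  congr 1
  funext x
  simp only [Function.comp, residueMap, ← hu, ← hv]
  linear_combination hzv

variable [Fintype (integers K ⧸ maxIdeal K)]

/-- Haar measure on the integers is the average of its images in the residue classes. -/
theorem isSelfSimilar_haarOnIntegers {π : K} (hπ : ‖π‖ < 1)
    (hdiv : ∀ x : K, ‖x‖ < 1 → ∃ z : K, ‖z‖ ≤ 1 ∧ x = π * z) :
    IsSelfSimilar (haarOnIntegers K) (integers K : Set K) (residueMap π) residueClass where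
  isProbabilityMeasure := isProbabilityMeasure_haarOnIntegers
  nonempty := ⟨0⟩
  measurable := measurable_residueMap π
  measurableSet := measurableSet_residueClass
  ae_mem := haarOnIntegers_ae_mem
  mapsTo a x hx := residueMap_mem_residueClass hπ hx a
  eq_sum := by
    have hp := isProbabilityMeasure_haarOnIntegers (K := K)
    symm
    have hprob : IsProbabilityMeasure (∑ a, (Fintype.card (integers K ⧸ maxIdeal K) : ENNReal)⁻¹ •
        (haarOnIntegers K).map (residueMap π a)) := by
      refine ⟨?_⟩
      have : ∀ a, (haarOnIntegers K).map (residueMap π a) univ = 1 := fun a => by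
        rw [Measure.map_apply (measurable_residueMap π a) MeasurableSet.univ]; simp
      simp only [Measure.finsetSum_apply, Measure.smul_apply, this, smul_eq_mul, mul_one,
        Finset.sum_const, Finset.card_univ, nsmul_eq_mul]
      exact ENNReal.mul_inv_cancel (by simp) (by simp)
    -- By uniqueness it suffices that the average is invariant and carried by `R`. Translation by an
    -- integer only permutes the summands.
    refine eq_haarOnIntegers (fun y hy => ?_) (ae_finsetSum_measure fun a _ => ?_)
    · rw [← Measure.mapₗ_apply_of_measurable (measurable_add_const y), map_sum]
      simp_rw [map_smul, Measure.mapₗ_apply_of_measurable (measurable_add_const y),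
        map_add_map_residueMap hdiv hy]
      exact Equiv.sum_comp (Equiv.addRight (Ideal.Quotient.mk (maxIdeal K) ⟨y, hy⟩)) fun a =>
        (Fintype.card (integers K ⧸ maxIdeal K) : ENNReal)⁻¹ •
          (haarOnIntegers K).map (residueMap π a)
    · refine Measure.ae_smul_measure ?_ _
      refine (ae_map_iff (p := fun x => x ∈ integers K) (measurable_residueMap π a).aemeasurable
        measurableSet_integers).2 ?_
      filter_upwards [haarOnIntegers_ae_mem] with x hx
      have h1 : π * x ∈ integers K := (norm_mul_lt_one hπ hx).le
      exact (integers K).add_mem (Subtype.coe_prop _) h1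

/-- The restriction of Haar measure to the open unit ball is a rescaled copy. -/
theorem haarOnIntegers_restrict_ball {π : K} (hπ : ‖π‖ < 1)
    (hdiv : ∀ x : K, ‖x‖ < 1 → ∃ z : K, ‖z‖ ≤ 1 ∧ x = π * z) :
    (haarOnIntegers K).restrict {x | ‖x‖ < 1} =
      (Fintype.card (integers K ⧸ maxIdeal K) : ENNReal)⁻¹ •
        (haarOnIntegers K).map (fun x => π * x) := by
  set P : Set K := {x | ‖x‖ < 1} with hP
  have hPm : MeasurableSet P := (isOpen_lt continuous_norm continuous_const).measurableSet
  have hπm : Measurable fun x : K => π * x := (continuous_const_mul π).measurable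
  -- The chosen representative of the zero class need not be `0`. It lies in the open ball, so it is
  -- `π * z` and can be removed by invariance under `z`.
  set u : integers K := Quotient.out (0 : integers K ⧸ maxIdeal K) with hu
  have hu0 : ‖(u : K)‖ < 1 := by
    have h0 : Ideal.Quotient.mk (maxIdeal K) u = 0 := Quotient.out_eq _
    exact (Ideal.Quotient.eq_zero_iff_mem.1 h0 : u ∈ maxIdeal K)
  have hclass : residueClass (0 : integers K ⧸ maxIdeal K) = P := by
    ext x
    simp only [residueClass, hP, mem_ofPred_eq, ← hu]
    constructor
    · intro h
      have := IsUltrametricDist.norm_add_le_max (x - u) u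
      rw [sub_add_cancel] at this
      exact this.trans_lt (max_lt h hu0)
    · intro h
      have := IsUltrametricDist.norm_add_le_max x (-u : K)
      rw [← sub_eq_add_neg, norm_neg] at this
      exact this.trans_lt (max_lt h hu0)
  have hmap : (haarOnIntegers K).map (residueMap π 0) = (haarOnIntegers K).map fun x => π * x := by
    obtain ⟨z, hz, hzu⟩ := hdiv _ hu0
    conv_rhs => rw [← isIntegerInvariant_haarOnIntegers z hz]
    rw [Measure.map_map hπm (measurable_add_const z)]
    congr 1
    funext x
    simp only [Function.comp, residueMap, ← hu, hzu]
    ring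
  refine Measure.ext fun E hE => ?_
  rw [Measure.restrict_apply hE]
  nth_rewrite 1 [(isSelfSimilar_haarOnIntegers hπ hdiv).eq_sum]
  rw [Measure.finsetSum_apply, Finset.sum_eq_single 0]
  · rw [hmap, Measure.smul_apply, Measure.smul_apply,
      Measure.map_apply hπm (hE.inter hPm), Measure.map_apply hπm hE]
    congr 1
    refine measure_congr ?_
    filter_upwards [haarOnIntegers_ae_mem] with x hx
    refine propext ⟨fun h => h.1, fun h => ⟨h, norm_mul_lt_one hπ hx⟩⟩
  · intro b _ hb
    rw [Measure.smul_apply, Measure.map_apply (measurable_residueMap π b) (hE.inter hPm)]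
    refine smul_eq_zero_of_right _ ?_
    rw [measure_eq_zero_iff_ae_notMem]
    filter_upwards [haarOnIntegers_ae_mem] with x hx h
    have h1 := norm_sub_eq_one_of_residueClass hb (residueMap_mem_residueClass hπ hx b)
      (hclass.symm ▸ h.2)
    simp at h1
  · simp

end Haar

/-! ### The partition function of the integers -/

section Weights

variable {K : Type*} [NontriviallyNormedField K]

/-- The complex pair weight `|x - y|^β`. -/
noncomputable def normWeight (β : ℂ) (x y : K) : ℂ := ((‖x - y‖ : ℝ) : ℂ) ^ β

/-- The pair weight `|x - y|^σ`, truncated so as to be bounded. -/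
noncomputable def truncWeight (ρ σ : ℝ) (M : ℕ) (x y : K) : ℝ :=
  (max (min ‖x - y‖ 1) (ρ ^ M)) ^ σ

theorem truncWeight_nonneg {ρ : ℝ} (hρ : 0 < ρ) (σ : ℝ) (M : ℕ) (x y : K) :
    0 ≤ truncWeight ρ σ M x y :=
  Real.rpow_nonneg (le_max_of_le_right (pow_nonneg hρ.le M)) _

/-- The floor `ρ ^ M` controls negative powers, the cap `1` nonnegative ones. -/
theorem truncWeight_le {ρ : ℝ} (hρ : 0 < ρ) (hρ1 : ρ ≤ 1) (σ : ℝ) (M : ℕ) (x y : K) :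
    ‖truncWeight ρ σ M x y‖ ≤ max 1 ((ρ ^ M) ^ σ) := by
  rw [Real.norm_of_nonneg (truncWeight_nonneg hρ σ M x y), truncWeight]
  have h1 : ρ ^ M ≤ max (min ‖x - y‖ 1) (ρ ^ M) := le_max_right _ _
  have h2 : max (min ‖x - y‖ 1) (ρ ^ M) ≤ 1 :=
    max_le (min_le_right _ _) (pow_le_one₀ hρ.le hρ1)
  have h0 : 0 < ρ ^ M := pow_pos hρ M
  rcases le_total 0 σ with hσ | hσ
  · exact le_max_of_le_left (Real.rpow_le_one (h0.le.trans h1) h2 hσ)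
  · exact le_max_of_le_right (Real.rpow_le_rpow_of_nonpos h0 h1 hσ)

variable [MeasurableSpace K] [BorelSpace K] [LocallyCompactSpace K]

theorem measurable_normWeight (β : ℂ) :
    Measurable (Function.uncurry (normWeight β : K → K → ℂ)) := by
  have := secondCountable_of_locallyCompact K
  have h : Continuous fun p : K × K => ((‖p.1 - p.2‖ : ℝ) : ℂ) := by fun_prop
  exact h.measurable.pow_const β

theorem measurable_truncWeight (ρ σ : ℝ) (M : ℕ) :
    Measurable (Function.uncurry (truncWeight ρ σ M : K → K → ℝ)) := by
  have := secondCountable_of_locallyCompact K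
  have h : Continuous fun p : K × K => max (min ‖p.1 - p.2‖ 1) (ρ ^ M) := by fun_prop
  exact h.measurable.pow_const σ

end Weights

/-! ### Absolute convergence and evaluation over the integers -/

section Integers

variable {K : Type*} [NontriviallyNormedField K]

/-- For distinct points there is equality once `ρ ^ M` is below all distances. If two points
coincide, the left side is `0` for `β ≠ 0`, as `0 ^ β = 0`, while for `β = 0` both sides are `1`.
Hence the diagonals need not be shown to be null. -/
theorem eventually_norm_pairProd_le {N : ℕ} {ρ : ℝ} (hρ : 0 < ρ) (hρ1 : ρ < 1) (β : ℂ)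
    (x : Fin N → K) (hx : ∀ i j, ‖x i - x j‖ ≤ 1) :
    ∀ᶠ M in Filter.atTop, ‖pairProd (normWeight β) x‖ ≤ pairProd (truncWeight ρ β.re M) x := by
  have hnn : ∀ M, 0 ≤ pairProd (truncWeight ρ β.re M) x := fun M =>
    Finset.prod_nonneg fun i _ => Finset.prod_nonneg fun j _ => by
      split_ifs
      · exact truncWeight_nonneg hρ _ _ _ _
      · exact zero_le_one
  by_cases h : ∃ i j, i < j ∧ x i = x j
  · obtain ⟨i, j, hij, hxij⟩ := h
    rcases eq_or_ne β 0 with rfl | hβ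
    · refine .of_forall fun M => le_of_eq ?_
      simp [pairProd, normWeight, truncWeight]
    · refine .of_forall fun M => ?_
      rw [pairProd, Finset.prod_eq_zero (Finset.mem_univ i), norm_zero]
      · exact hnn M
      · refine Finset.prod_eq_zero (Finset.mem_univ j) ?_
        simp [hij, hxij, normWeight, hβ]
  · push Not at h
    have hev : ∀ᶠ M in Filter.atTop, ∀ i j, i < j → ρ ^ M ≤ ‖x i - x j‖ := by
      refine Filter.eventually_all.2 fun i => Filter.eventually_all.2 fun j => ?_
      by_cases hij : i < j
      · have hpos : 0 < ‖x i - x j‖ := norm_pos_iff.2 (sub_ne_zero.2 (h i j hij))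
        filter_upwards [(tendsto_pow_atTop_nhds_zero_of_lt_one hρ.le hρ1).eventually_lt_const
          hpos] with M hM _
        exact hM.le
      · exact .of_forall fun M hij' => absurd hij' hij
    filter_upwards [hev] with M hM
    refine le_of_eq ?_
    rw [pairProd, norm_prod, pairProd]
    refine Finset.prod_congr rfl fun i _ => ?_
    rw [norm_prod]
    refine Finset.prod_congr rfl fun j _ => ?_
    split_ifs with hij
    · have hpos : 0 < ‖x i - x j‖ := norm_pos_iff.2 (sub_ne_zero.2 (h i j hij))
      rw [normWeight, truncWeight, Complex.norm_cpow_eq_rpow_re_of_pos hpos, min_eq_left (hx i j),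
        max_eq_left (hM i j hij)]
    · simp

variable [IsUltrametricDist K]

theorem norm_sub_le_one {x y : K} (hx : x ∈ integers K) (hy : y ∈ integers K) : ‖x - y‖ ≤ 1 :=
  (integers K).sub_mem hx hy

theorem norm_residueMap_sub (π : K) (a : integers K ⧸ maxIdeal K) (x y : K) :
    ‖residueMap π a x - residueMap π a y‖ = ‖π‖ * ‖x - y‖ := by
  rw [← norm_mul]
  congr 1
  simp only [residueMap]
  ring

variable [MeasurableSpace K] [BorelSpace K] [LocallyCompactSpace K]

/-- The contraction factor of the truncated recurrence is `q ^ (1 - (n + (n choose 2) σ))`. -/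
theorem inv_mul_pow_mul_rpow_lt_one {q : ℝ} (hq : 1 < q) {N n : ℕ} (hn : 2 ≤ n) (hnN : n ≤ N)
    {σ : ℝ} (hσ : -2 / (N : ℝ) < σ) : q * (q⁻¹ ^ n * (q⁻¹ ^ σ) ^ n.choose 2) < 1 := by
  have hq0 : 0 < q := by linarith
  have h1 := one_lt_add_choose_mul hn (neg_two_div_lt_of_le (by omega) hnN hσ)
  have : q * (q⁻¹ ^ n * (q⁻¹ ^ σ) ^ n.choose 2) = q ^ (1 - (n + n.choose 2 * σ)) := by
    rw [Real.inv_rpow hq0.le, inv_pow, inv_pow, Real.rpow_sub hq0, Real.rpow_one,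
      Real.rpow_add hq0, Real.rpow_natCast, mul_comm (n.choose 2 : ℝ), Real.rpow_mul_natCast hq0.le]
    field_simp
  rw [this]
  exact Real.rpow_lt_one_of_one_lt_of_neg hq (by linarith)

/-- Absolute convergence over the integers. -/
theorem pairIntegrable_normWeight (hK : HasCanonicalNorm K) {N : ℕ} {β : ℂ}
    (hβ : -2 / (N : ℝ) < β.re) {n : ℕ} (hn : n ≤ N) :
    PairIntegrable (normWeight β) (haarOnIntegers K) n := by
  obtain ⟨hq, π, hπ, hdiv⟩ := hK.exists_uniformizer
  have hp := isProbabilityMeasure_haarOnIntegers (K := K)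
  have hfin : Finite (integers K ⧸ maxIdeal K) :=
    Nat.finite_of_card_ne_zero (show residueCard K ≠ 0 by omega)
  have := Fintype.ofFinite (integers K ⧸ maxIdeal K)
  have hcard : Fintype.card (integers K ⧸ maxIdeal K) = residueCard K :=
    (Nat.card_eq_fintype_card).symm
  have hq1 : (1 : ℝ) < residueCard K := by exact_mod_cast (by omega : 1 < residueCard K)
  set ρ : ℝ := (residueCard K : ℝ)⁻¹ with hρdef
  have hρ0 : 0 < ρ := inv_pos.2 (by linarith)
  have hρ1 : ρ < 1 := inv_lt_one_of_one_lt₀ hq1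
  have hsim := isSelfSimilar_haarOnIntegers (hπ.trans_lt hρ1) hdiv
  have hint : ∀ M k, PairIntegrable (truncWeight ρ β.re M) (haarOnIntegers K) k := fun M k =>
    pairIntegrable_of_bound (measurable_truncWeight ρ β.re M)
      (truncWeight_le hρ0 hρ1.le β.re M) _ _
  obtain ⟨B, hB⟩ := hsim.exists_bound (w := truncWeight ρ β.re) (r := ρ ^ β.re) (N := N)
    (measurable_truncWeight ρ β.re) (truncWeight_nonneg hρ0 β.re) (Real.rpow_nonneg hρ0.le _) hint
    -- On `R` the cap at `1` is inactive, and multiplication by `π` scales the distance and the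
    -- floor by the same `ρ`, turning level `M` into level `M + 1`.
    (fun M a x hx y hy => by
      have h1 := norm_sub_le_one hx hy
      have h2 : ρ * ‖x - y‖ ≤ 1 := (mul_le_of_le_one_right hρ0.le h1).trans hρ1.le
      rw [truncWeight, truncWeight, norm_residueMap_sub, hπ, min_eq_left h1, min_eq_left h2,
        pow_succ', ← mul_max_of_nonneg _ _ hρ0.le, Real.mul_rpow hρ0.le]
      exact le_max_of_le_left (norm_nonneg _))
    (fun M a b hab x hx y hy => by
      rw [truncWeight, norm_sub_eq_one_of_residueClass hab hx hy, min_self,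
        max_eq_left (pow_le_one₀ hρ0.le hρ1.le), Real.one_rpow])
    (fun n h2 hnN => by
      rw [hcard]
      exact inv_mul_pow_mul_rpow_lt_one hq1 h2 hnN hβ) n hn
  refine ⟨(measurable_pairProd (measurable_normWeight β)).aestronglyMeasurable, ?_⟩
  have hbound : ∀ M, ∫⁻ x : Fin n → K, ENNReal.ofReal (pairProd (truncWeight ρ β.re M) x)
      ∂(Measure.pi fun _ => haarOnIntegers K) ≤ ENNReal.ofReal B := by
    intro M
    rw [← ofReal_integral_eq_lintegral_ofReal (hint M n)]
    · exact ENNReal.ofReal_le_ofReal (hB M)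
    · refine .of_forall fun x => Finset.prod_nonneg fun i _ => Finset.prod_nonneg fun j _ => ?_
      split_ifs
      · exact truncWeight_nonneg hρ0 _ _ _ _
      · exact zero_le_one
  have hmem : ∀ᵐ x ∂(Measure.pi fun _ : Fin n => haarOnIntegers K), ∀ i, x i ∈ integers K :=
    Filter.eventually_all.2 fun i =>
      (Measure.tendsto_eval_ae_ae (i := i)).eventually haarOnIntegers_ae_mem
  -- Fatou's lemma carries the uniform bound over to the weight without truncation.
  rw [HasFiniteIntegral]
  refine lt_of_le_of_lt ?_ (ENNReal.ofReal_lt_top (r := B))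
  calc ∫⁻ x : Fin n → K, ‖pairProd (normWeight β) x‖ₑ ∂(Measure.pi fun _ => haarOnIntegers K)
      ≤ ∫⁻ x : Fin n → K, Filter.liminf (fun M => ENNReal.ofReal
          (pairProd (truncWeight ρ β.re M) x)) Filter.atTop
          ∂(Measure.pi fun _ => haarOnIntegers K) := by
        refine lintegral_mono_ae ?_
        filter_upwards [hmem] with x hx
        refine Filter.le_liminf_of_le (by isBoundedDefault) ?_
        filter_upwards [eventually_norm_pairProd_le hρ0 hρ1 β x
          fun i j => norm_sub_le_one (hx i) (hx j)] with M hM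
        rw [← ofReal_norm]
        exact ENNReal.ofReal_le_ofReal hM
    _ ≤ Filter.liminf (fun M => ∫⁻ x : Fin n → K, ENNReal.ofReal
          (pairProd (truncWeight ρ β.re M) x) ∂(Measure.pi fun _ => haarOnIntegers K))
          Filter.atTop :=
        lintegral_liminf_le fun M => (measurable_pairProd
          (measurable_truncWeight ρ β.re M)).ennreal_ofReal
    _ ≤ ENNReal.ofReal B := by
        refine Filter.liminf_le_of_le (by isBoundedDefault) fun b hb => ?_
        obtain ⟨M, hM⟩ := hb.exists
        exact hM.trans (hbound M)

theorem ofReal_inv_cpow {q : ℕ} (hq : 0 < q) (β : ℂ) :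
    (((q : ℝ)⁻¹ : ℝ) : ℂ) ^ β = Complex.exp (-(Real.log q * β)) := by
  have hq0 : (0 : ℝ) < (q : ℝ)⁻¹ := inv_pos.2 (by exact_mod_cast hq)
  rw [Complex.cpow_def_of_ne_zero (by exact_mod_cast hq0.ne'), ← Complex.ofReal_log hq0.le,
    Real.log_inv]
  congr 1
  push_cast
  ring

theorem inv_pow_mul_cpow_pow {q : ℕ} (hq : 0 < q) (β : ℂ) (k : ℕ) :
    ((q : ℂ)⁻¹) ^ k * ((((q : ℝ)⁻¹ : ℝ) : ℂ) ^ β) ^ k.choose 2 =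
      Complex.exp (-(Real.log q * expo k β)) := by
  have h1 : (q : ℂ)⁻¹ = Complex.exp (-(Real.log q : ℂ)) := by
    rw [Complex.exp_neg, ← Complex.ofReal_exp, Real.exp_log (by exact_mod_cast hq)]
    simp
  rw [ofReal_inv_cpow hq, h1, ← Complex.exp_nat_mul, ← Complex.exp_nat_mul, ← Complex.exp_add]
  congr 1
  simp only [expo]
  ring

theorem mul_norm_cpow {r : ℝ} (hr : 0 ≤ r) (s : ℝ) (hs : 0 ≤ s) (β : ℂ) :
    (((r * s : ℝ)) : ℂ) ^ β = (r : ℂ) ^ β * (s : ℂ) ^ β := by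
  rw [Complex.ofReal_mul, Complex.mul_cpow_ofReal_nonneg hr hs]

/-- The partition functions of the integers in terms of the functions `F_n`. -/
theorem pairIntegral_haarOnIntegers (hK : HasCanonicalNorm K) {N : ℕ} {β : ℂ}
    (hβ : -2 / (N : ℝ) < β.re) {n : ℕ} (hn : n ≤ N) :
    pairIntegral (normWeight β) (haarOnIntegers K) n = n.factorial *
      Complex.exp ((Real.log (residueCard K) : ℝ) / 2 * (n.choose 2 * β)) *
        F n (Real.log (residueCard K)) β := by
  obtain ⟨hq, π, hπ, hdiv⟩ := hK.exists_uniformizer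
  have hp := isProbabilityMeasure_haarOnIntegers (K := K)
  have hfin : Finite (integers K ⧸ maxIdeal K) :=
    Nat.finite_of_card_ne_zero (show residueCard K ≠ 0 by omega)
  have := Fintype.ofFinite (integers K ⧸ maxIdeal K)
  have hcard : Fintype.card (integers K ⧸ maxIdeal K) = residueCard K :=
    (Nat.card_eq_fintype_card).symm
  have hq1 : (1 : ℝ) < residueCard K := by exact_mod_cast (by omega : 1 < residueCard K)
  have hsim := isSelfSimilar_haarOnIntegers (hπ.trans_lt (inv_lt_one_of_one_lt₀ hq1)) hdiv
  refine eq_factorial_mul_exp_mul_F hq hβ rfl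
    (Z := pairIntegral (normWeight β) (haarOnIntegers K))
    (fun n hn => pairIntegral_of_le_one hn) (fun n hn => ?_) hn
  rw [(hsim.pairIntegral_eq (v := normWeight β) (w := normWeight β)
    (r := (((residueCard K : ℝ)⁻¹ : ℝ) : ℂ) ^ β) (measurable_normWeight β)
    (fun a x _ y _ => by
      rw [normWeight, normWeight, norm_residueMap_sub, hπ,
        mul_norm_cpow (by positivity) _ (norm_nonneg _)])
    (fun a b hab x hx y hy => by
      rw [normWeight, norm_sub_eq_one_of_residueClass hab hx hy]
      simp)
    (fun k hk => pairIntegrable_normWeight hK hβ (hk.trans hn))).2, hcard]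
  exact convPow_congr _ _ fun k _ => by rw [← inv_pow_mul_cpow_pow (by omega)]

end Integers

/-! ### The invariant measure of the projective line -/

section Charts

variable {K : Type*} [NontriviallyNormedField K]

/-- The affine chart `x ↦ [x : 1]`. -/
def chart (x : K) : ProjLine K :=
  Projectivization.mk K ![x, 1] fun h => one_ne_zero (congrFun h 1)

/-- The affine chart `y ↦ [1 : y]` around infinity. -/
def chartInfty (y : K) : ProjLine K :=
  Projectivization.mk K ![1, y] fun h => one_ne_zero (congrFun h 0)

/-- The affine coordinate `[x : y] ↦ x / y`. -/
noncomputable def affineCoord (p : ProjLine K) : K := p.rep 0 / p.rep 1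

/-- The finite part of the projective line. -/
def finitePart (K : Type*) [NontriviallyNormedField K] : Set (ProjLine K) := {p | p.rep 1 ≠ 0}

theorem affineCoord_mk (v : Fin 2 → K) (hv : v ≠ 0) :
    affineCoord (Projectivization.mk K v hv) = v 0 / v 1 := by
  obtain ⟨a, ha⟩ := Projectivization.exists_smul_eq_mk_rep K v hv
  rw [affineCoord, ← ha]
  simp only [Pi.smul_apply, Units.smul_def, smul_eq_mul]
  exact mul_div_mul_left _ _ a.ne_zero

theorem mk_mem_finitePart (v : Fin 2 → K) (hv : v ≠ 0) :
    Projectivization.mk K v hv ∈ finitePart K ↔ v 1 ≠ 0 := by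
  obtain ⟨a, ha⟩ := Projectivization.exists_smul_eq_mk_rep K v hv
  rw [finitePart, mem_ofPred_eq, ← ha]
  simp [Units.smul_def]

theorem affineCoord_chart (x : K) : affineCoord (chart x) = x := by
  simp [chart, affineCoord_mk]

theorem chart_mem_finitePart (x : K) : chart x ∈ finitePart K := by
  simp [chart, mk_mem_finitePart]

theorem chart_affineCoord {p : ProjLine K} (hp : p ∈ finitePart K) :
    chart (affineCoord p) = p := by
  induction p using Projectivization.ind with
  | h v hv =>
    rw [mk_mem_finitePart] at hp
    rw [affineCoord_mk, chart, Projectivization.mk_eq_mk_iff']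
    refine ⟨(v 1)⁻¹, ?_⟩
    funext i
    fin_cases i <;> simp <;> field_simp

theorem eq_chartInfty_zero {p : ProjLine K} (hp : p ∉ finitePart K) : p = chartInfty 0 := by
  induction p using Projectivization.ind with
  | h v hv =>
    rw [mk_mem_finitePart, not_not] at hp
    rw [chartInfty, Projectivization.mk_eq_mk_iff']
    refine ⟨v 0, ?_⟩
    funext i
    fin_cases i <;> simp [hp]

theorem continuous_mk' : Continuous (Projectivization.mk' K (V := Fin 2 → K)) :=
  continuous_coinduced_rng

theorem continuous_chart : Continuous (chart : K → ProjLine K) := by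
  have h : Continuous fun x : K => (⟨![x, 1], fun h => one_ne_zero (congrFun h 1)⟩ :
      {v : Fin 2 → K // v ≠ 0}) := by
    refine Continuous.subtype_mk ?_ _
    refine continuous_pi fun i => ?_
    fin_cases i
    · exact continuous_id
    · exact continuous_const
  exact continuous_mk'.comp h

theorem continuous_chartInfty : Continuous (chartInfty : K → ProjLine K) := by
  have h : Continuous fun x : K => (⟨![1, x], fun h => one_ne_zero (congrFun h 0)⟩ :
      {v : Fin 2 → K // v ≠ 0}) := by
    refine Continuous.subtype_mk ?_ _
    refine continuous_pi fun i => ?_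
    fin_cases i
    · exact continuous_const
    · exact continuous_id
  exact continuous_mk'.comp h

theorem isOpen_finitePart_inter {W : Set K} (hW : IsOpen W) :
    IsOpen (finitePart K ∩ affineCoord ⁻¹' W) := by
  refine isOpen_coinduced.2 ?_
  have : (Projectivization.mk' K (V := Fin 2 → K)) ⁻¹' (finitePart K ∩ affineCoord ⁻¹' W) =
      {v : {v : Fin 2 → K // v ≠ 0} | (v : Fin 2 → K) 1 ≠ 0} ∩
        (fun v : {v : Fin 2 → K // v ≠ 0} => (v : Fin 2 → K) 0 / (v : Fin 2 → K) 1) ⁻¹' W := by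
    ext ⟨v, hv⟩
    simp only [mem_preimage, mem_inter_iff, Projectivization.mk'_eq_mk, mk_mem_finitePart,
      affineCoord_mk, mem_ofPred_eq]
  rw [this]
  have h0 : ∀ i, Continuous fun v : {v : Fin 2 → K // v ≠ 0} => (v : Fin 2 → K) i := fun i =>
    (continuous_apply i).comp continuous_subtype_val
  refine ContinuousOn.isOpen_inter_preimage ?_ ?_ hW
  · exact (h0 0).continuousOn.div (h0 1).continuousOn fun v hv => hv
  · exact isOpen_ne_fun (h0 1) continuous_const

theorem isOpen_finitePart : IsOpen (finitePart K) := by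
  simpa using isOpen_finitePart_inter (K := K) isOpen_univ

theorem image_chart (E : Set K) : chart '' E = finitePart K ∩ affineCoord ⁻¹' E := by
  ext p
  constructor
  · rintro ⟨x, hx, rfl⟩
    exact ⟨chart_mem_finitePart x, by rwa [mem_preimage, affineCoord_chart]⟩
  · rintro ⟨h1, h2⟩
    exact ⟨_, h2, chart_affineCoord h1⟩

open Classical in
/-- A measurable choice of homogeneous coordinates. -/
noncomputable def homCoord (p : ProjLine K) : Fin 2 → K :=
  if p ∈ finitePart K then ![affineCoord p, 1] else ![1, 0]

theorem exists_mk_homCoord (p : ProjLine K) :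
    ∃ h : homCoord p ≠ 0, Projectivization.mk K (homCoord p) h = p := by
  unfold homCoord
  by_cases hp : p ∈ finitePart K
  · simp only [if_pos hp]
    exact ⟨fun h => one_ne_zero (congrFun h 1), chart_affineCoord hp⟩
  · simp only [if_neg hp]
    exact ⟨fun h => one_ne_zero (congrFun h 0), (eq_chartInfty_zero hp).symm⟩

variable [MeasurableSpace K] [BorelSpace K]

theorem measurable_affineCoord : Measurable (affineCoord : ProjLine K → K) := by
  refine measurable_of_isOpen fun W hW => ?_
  rw [← inter_union_compl (affineCoord ⁻¹' W) (finitePart K)]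
  refine MeasurableSet.union ?_ ?_
  · rw [inter_comm]
    exact (isOpen_finitePart_inter hW).measurableSet
  -- Off the finite part the coordinate is `x / 0 = 0`, so the preimage contains all of the
  -- complement or none of it.
  · by_cases h : (0 : K) ∈ W
    · have : affineCoord ⁻¹' W ∩ (finitePart K)ᶜ = (finitePart K)ᶜ := by
        refine inter_eq_right.2 fun p hp => ?_
        have hp' : p.rep 1 = 0 := not_not.1 hp
        simpa [affineCoord, hp'] using h
      rw [this]
      exact isOpen_finitePart.measurableSet.compl
    · have : affineCoord ⁻¹' W ∩ (finitePart K)ᶜ = ∅ := by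
        refine eq_empty_of_forall_notMem fun p hp => h ?_
        have hp' : p.rep 1 = 0 := not_not.1 hp.2
        simpa [affineCoord, hp'] using hp.1
      rw [this]
      exact MeasurableSet.empty

theorem measurableSet_image_chart {E : Set K} (hE : MeasurableSet E) :
    MeasurableSet (chart '' E) := by
  rw [image_chart]
  exact isOpen_finitePart.measurableSet.inter (measurable_affineCoord hE)

theorem measurable_homCoord (i : Fin 2) : Measurable fun p : ProjLine K => homCoord p i := by
  classical
  have : (fun p : ProjLine K => homCoord p i) = fun p =>
      if p ∈ finitePart K then (![affineCoord p, 1] : Fin 2 → K) i else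
        (![1, 0] : Fin 2 → K) i := by
    funext p
    unfold homCoord
    split_ifs <;> rfl
  rw [this]
  refine Measurable.ite isOpen_finitePart.measurableSet ?_ measurable_const
  fin_cases i
  · exact measurable_affineCoord
  · exact measurable_const

/-- The representatives `rep` are arbitrary choices, so the distance is recomputed with the
measurable coordinates `homCoord`. -/
theorem measurable_sphDist [LocallyCompactSpace K] :
    Measurable (Function.uncurry (sphDist (K := K))) := by
  have := secondCountable_of_locallyCompact K
  have : Function.uncurry (sphDist (K := K)) = fun z =>
      ‖homCoord z.1 0 * homCoord z.2 1 - homCoord z.1 1 * homCoord z.2 0‖ /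
        (max ‖homCoord z.1 0‖ ‖homCoord z.1 1‖ * max ‖homCoord z.2 0‖ ‖homCoord z.2 1‖) := by
    funext ⟨p, p'⟩
    obtain ⟨h, hp⟩ := exists_mk_homCoord p
    obtain ⟨h', hp'⟩ := exists_mk_homCoord p'
    rw [← sphDist_mk _ _ h h', hp, hp']
    rfl
  rw [this]
  have h1 : ∀ i, Measurable fun z : ProjLine K × ProjLine K => homCoord z.1 i := fun i =>
    (measurable_homCoord i).comp measurable_fst
  have h2 : ∀ i, Measurable fun z : ProjLine K × ProjLine K => homCoord z.2 i := fun i =>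
    (measurable_homCoord i).comp measurable_snd
  exact (((h1 0).mul (h2 1)).sub ((h1 1).mul (h2 0))).norm.div
    (((h1 0).norm.max (h1 1).norm).mul ((h2 0).norm.max (h2 1).norm))

end Charts

/-! ### The spherical distance and the invariant measure in the two charts -/

section Invariant

variable {K : Type*} [NontriviallyNormedField K]

theorem sphDist_chart {x y : K} (hx : ‖x‖ ≤ 1) (hy : ‖y‖ ≤ 1) :
    sphDist (chart x) (chart y) = ‖x - y‖ := by
  simp [chart, sphDist_mk, max_eq_right hx, max_eq_right hy]

theorem sphDist_chartInfty {x y : K} (hx : ‖x‖ ≤ 1) (hy : ‖y‖ ≤ 1) :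
    sphDist (chartInfty x) (chartInfty y) = ‖x - y‖ := by
  simp [chartInfty, sphDist_mk, max_eq_left hx, max_eq_left hy, norm_sub_rev y x]

theorem sphDist_comm (p p' : ProjLine K) : sphDist p p' = sphDist p' p := by
  unfold sphDist
  rw [mul_comm (max ‖p.rep 0‖ ‖p.rep 1‖), ← norm_neg]
  congr 2
  ring

variable [IsUltrametricDist K]

/-- The determinant is `x y - 1` with `|x y| < 1`, hence of norm `1`. -/
theorem sphDist_chart_chartInfty {x y : K} (hx : ‖x‖ ≤ 1) (hy : ‖y‖ < 1) :
    sphDist (chart x) (chartInfty y) = 1 := by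
  have hxy : ‖x * y‖ < 1 := by
    rw [norm_mul]
    exact (mul_le_of_le_one_left (norm_nonneg _) hx).trans_lt hy
  have : ‖x * y - 1‖ = 1 := by
    rw [sub_eq_add_neg, IsUltrametricDist.norm_add_eq_max_of_norm_ne_norm
      (by rw [norm_neg, norm_one]; exact hxy.ne), norm_neg, norm_one, max_eq_right hxy.le]
  simp [chart, chartInfty, sphDist_mk, max_eq_right hx, max_eq_left hy.le, this]

theorem compl_image_chart : (chart '' (integers K : Set K))ᶜ = chartInfty '' {x | ‖x‖ < 1} := by
  ext p
  constructor
  · intro hp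
    by_cases h : p ∈ finitePart K
    · have h1 : ¬ ‖affineCoord p‖ ≤ 1 := fun h1 => hp ⟨_, h1, chart_affineCoord h⟩
      push Not at h1
      have h0 : affineCoord p ≠ 0 := by
        intro h0
        rw [h0, norm_zero] at h1
        linarith
      refine ⟨(affineCoord p)⁻¹, ?_, ?_⟩
      · rw [mem_ofPred_eq, norm_inv]
        exact inv_lt_one_of_one_lt₀ h1
      · rw [← chart_affineCoord h, affineCoord_chart, chartInfty, chart,
          Projectivization.mk_eq_mk_iff']
        refine ⟨(affineCoord p)⁻¹, ?_⟩
        funext i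
        fin_cases i <;> simp [h0]
    · exact ⟨0, by simp, (eq_chartInfty_zero h).symm⟩
  -- A point common to both images would be at distance `1` from itself.
  · rintro ⟨y, hy, rfl⟩ ⟨x, hx, hxy⟩
    have h1 := sphDist_chart_chartInfty hx hy
    rw [hxy, sphDist_chartInfty (le_of_lt hy) (le_of_lt hy)] at h1
    simp at h1

/-- The integral matrix of the translation by `y`. -/
noncomputable def translationMatrix (y : integers K) : GL (Fin 2) (integers K) :=
  Matrix.GeneralLinearGroup.mk'' !![1, y; 0, 1] (by simp [Matrix.det_fin_two])

variable (K) in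
/-- The integral matrix of the inversion. -/
noncomputable def swapMatrix : GL (Fin 2) (integers K) :=
  Matrix.GeneralLinearGroup.mk'' !![0, 1; 1, 0] (by simp [Matrix.det_fin_two])

theorem translationMatrix_smul (y : integers K) (x : K) :
    Matrix.GeneralLinearGroup.map (integers K).subtype (translationMatrix y) • chart x =
      chart (x + y) := by
  rw [chart, Projectivization.smul_mk, chart]
  congr 1
  rw [Matrix.GeneralLinearGroup.fin_two_smul]
  funext i
  fin_cases i <;> simp [translationMatrix]

theorem swapMatrix_smul (x : K) :
    Matrix.GeneralLinearGroup.map (integers K).subtype (swapMatrix K) • chart x =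
      chartInfty x := by
  rw [chart, Projectivization.smul_mk, chartInfty]
  congr 1
  rw [Matrix.GeneralLinearGroup.fin_two_smul]
  funext i
  fin_cases i <;> simp [swapMatrix]

variable [MeasurableSpace K] [BorelSpace K]

theorem IsInvariantProbability.image_chart_add {ν : Measure (ProjLine K)}
    (hν : IsInvariantProbability K ν) {y : K} (hy : y ∈ integers K) {E : Set K}
    (hE : MeasurableSet E) : ν (chart '' ((fun x => x + y) ⁻¹' E)) = ν (chart '' E) := by
  rw [← hν.invariant (translationMatrix ⟨y, hy⟩) _
    (measurableSet_image_chart (measurable_add_const y hE)), image_image]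
  simp_rw [translationMatrix_smul]
  rw [← image_image chart fun x => x + y, image_preimage_eq _ (add_right_surjective y)]

theorem IsInvariantProbability.image_chartInfty {ν : Measure (ProjLine K)}
    (hν : IsInvariantProbability K ν) {E : Set K} (hE : MeasurableSet E) :
    ν (chartInfty '' E) = ν (chart '' E) := by
  rw [← hν.invariant (swapMatrix K) _ (measurableSet_image_chart hE), image_image]
  simp_rw [swapMatrix_smul]

variable [LocallyCompactSpace K]

/-- Pulled back to `R` and normalised, `ν` is a probability measure invariant under integral
translations, so uniqueness identifies it with Haar measure. -/
theorem IsInvariantProbability.apply_image_chart {ν : Measure (ProjLine K)}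
    (hν : IsInvariantProbability K ν) {E : Set K} (hE : MeasurableSet E) :
    ν (chart '' (E ∩ integers K)) = ν (chart '' (integers K : Set K)) * haarOnIntegers K E := by
  have := hν.isProbabilityMeasure
  set c := ν (chart '' (integers K : Set K)) with hc
  have hcT : c ≠ ⊤ := measure_ne_top _ _
  have hR := measurableSet_integers (K := K)
  have hball : MeasurableSet {x : K | ‖x‖ < 1} :=
    (isOpen_lt continuous_norm continuous_const).measurableSet
  -- If the chart image of `R` were null, the inversion would make its complement null as well,
  -- leaving total mass `0`.
  have hc0 : c ≠ 0 := by
    intro h0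
    have h1 : ν (chartInfty '' {x : K | ‖x‖ < 1}) = 0 := by
      rw [hν.image_chartInfty hball]
      refine measure_mono_null (image_mono fun x hx => ?_) h0
      exact (show ‖x‖ < 1 from hx).le
    have h2 := measure_add_measure_compl (μ := ν) (measurableSet_image_chart hR)
    rw [compl_image_chart, h1, ← hc, h0, measure_univ] at h2
    simp at h2
  set m : Measure K := c⁻¹ • (ν.restrict (chart '' (integers K : Set K))).map affineCoord with hm
  have happly : ∀ E, MeasurableSet E → m E = c⁻¹ * ν (chart '' (E ∩ integers K)) := by
    intro E hE
    rw [hm, Measure.smul_apply, Measure.map_apply measurable_affineCoord hE,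
      Measure.restrict_apply (measurable_affineCoord hE), image_chart, image_chart, smul_eq_mul]
    congr 2
    ext p
    simp only [mem_inter_iff, mem_preimage]
    tauto
  have hprob : IsProbabilityMeasure m := by
    refine ⟨?_⟩
    rw [happly _ MeasurableSet.univ, univ_inter, ← hc, ENNReal.inv_mul_cancel hc0 hcT]
  have hinv : IsIntegerInvariant m := by
    intro y hy
    refine Measure.ext fun E hE => ?_
    have hpre : (fun x => x + y) ⁻¹' (integers K : Set K) = integers K := by
      ext x
      exact (integers K).add_mem_cancel_right hy
    rw [Measure.map_apply (measurable_add_const y) hE, happly _ (measurable_add_const y hE),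
      happly _ hE, ← hν.image_chart_add hy (hE.inter hR), preimage_inter, hpre]
  have hmem : ∀ᵐ x ∂m, x ∈ integers K := by
    rw [ae_iff]
    refine (happly _ hR.compl).trans ?_
    simp
  rw [← eq_haarOnIntegers hinv hmem, happly E hE, ← mul_assoc, ENNReal.mul_inv_cancel hc0 hcT,
    one_mul]

/-- The invariant measure in terms of the two charts. -/
theorem IsInvariantProbability.eq_add {ν : Measure (ProjLine K)}
    (hν : IsInvariantProbability K ν) :
    ν = ν (chart '' (integers K : Set K)) • (haarOnIntegers K).map chart +
      ν (chart '' (integers K : Set K)) •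
        ((haarOnIntegers K).restrict {x | ‖x‖ < 1}).map chartInfty := by
  have hball : MeasurableSet {x : K | ‖x‖ < 1} :=
    (isOpen_lt continuous_norm continuous_const).measurableSet
  refine Measure.ext fun E hE => ?_
  have h1 : MeasurableSet (chart ⁻¹' E : Set K) := continuous_chart.measurable hE
  have h2 : MeasurableSet (chartInfty ⁻¹' E : Set K) := continuous_chartInfty.measurable hE
  rw [Measure.add_apply, Measure.smul_apply, Measure.smul_apply,
    Measure.map_apply continuous_chart.measurable hE,
    Measure.map_apply continuous_chartInfty.measurable hE, Measure.restrict_apply h2,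
    smul_eq_mul, smul_eq_mul, ← hν.apply_image_chart h1, ← hν.apply_image_chart (h2.inter hball),
    ← measure_inter_add_sdiff E (measurableSet_image_chart (measurableSet_integers (K := K)))]
  congr 1
  · rw [inter_comm (chart ⁻¹' E), image_inter_preimage, inter_comm]
  · have : chartInfty ⁻¹' E ∩ {x : K | ‖x‖ < 1} ∩ (integers K : Set K) =
        {x : K | ‖x‖ < 1} ∩ chartInfty ⁻¹' E := by
      ext x
      simp only [mem_inter_iff, mem_preimage, mem_ofPred_eq]
      exact ⟨fun h => ⟨h.1.2, h.1.1⟩, fun h => ⟨⟨h.2, h.1⟩, le_of_lt h.1⟩⟩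
    rw [this, sdiff_eq, compl_image_chart, inter_comm, ← image_inter_preimage]
    exact hν.image_chartInfty (hball.inter h2)

end Invariant

/-! ### The partition function of the projective line -/

section Projective

variable {K : Type*} [NontriviallyNormedField K]

/-- The complex pair weight `δ(x, y)^β`. -/
noncomputable def sphWeight (β : ℂ) (x y : ProjLine K) : ℂ := ((sphDist x y : ℝ) : ℂ) ^ β

theorem measurable_sphWeight [MeasurableSpace K] [BorelSpace K] [LocallyCompactSpace K] (β : ℂ) :
    Measurable (Function.uncurry (sphWeight β : ProjLine K → ProjLine K → ℂ)) :=
  (Complex.measurable_ofReal.comp measurable_sphDist).pow_const β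

variable [IsUltrametricDist K] [MeasurableSpace K] [BorelSpace K] [LocallyCompactSpace K]

/-- The two parts of `ν` are images of Haar measure on `R`, with distances scaled by `1` and by
`1/q`, and the weight between them is `1`; so the integral is a binomial convolution. -/
theorem pairIntegral_sphWeight {ν : Measure (ProjLine K)} (hν : IsInvariantProbability K ν)
    (hK : HasCanonicalNorm K) {N : ℕ} {β : ℂ} (hβ : -2 / (N : ℝ) < β.re) :
    PairIntegrable (sphWeight β) ν N ∧ pairIntegral (sphWeight β) ν N =
      ((residueCard K : ℂ) / (residueCard K + 1)) ^ N * ∑ k ∈ Finset.range (N + 1),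
        (N.choose k : ℂ) * (pairIntegral (normWeight β) (haarOnIntegers K) k *
          (Complex.exp (-(Real.log (residueCard K) * expo (N - k) β)) *
            pairIntegral (normWeight β) (haarOnIntegers K) (N - k))) := by
  obtain ⟨hq, π, hπ, hdiv⟩ := hK.exists_uniformizer
  have hp := isProbabilityMeasure_haarOnIntegers (K := K)
  have hνp := hν.isProbabilityMeasure
  have hfin : Finite (integers K ⧸ maxIdeal K) :=
    Nat.finite_of_card_ne_zero (show residueCard K ≠ 0 by omega)
  have := Fintype.ofFinite (integers K ⧸ maxIdeal K)
  have hcard : Fintype.card (integers K ⧸ maxIdeal K) = residueCard K :=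
    (Nat.card_eq_fintype_card).symm
  set q := residueCard K with hqdef
  have hq1 : (1 : ℝ) < q := by exact_mod_cast (by omega : 1 < q)
  have hπ1 : ‖π‖ < 1 := hπ.trans_lt (inv_lt_one_of_one_lt₀ hq1)
  have hπm : Measurable fun x : K => π * x := (continuous_const_mul π).measurable
  have hψ := continuous_chart (K := K) |>.measurable
  have hψi := continuous_chartInfty (K := K) |>.measurable
  set c := ν (chart '' (integers K : Set K)) with hc
  have hcT : c ≠ ⊤ := measure_ne_top _ _
  have heq := hν.eq_add
  rw [haarOnIntegers_restrict_ball hπ1 hdiv, hcard, Measure.map_smul,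
    Measure.map_map hψi hπm, smul_smul] at heq
  have hqinv : ((q : ENNReal)⁻¹) ≠ ⊤ := by simp; omega
  have hcq : c * (q : ENNReal)⁻¹ ≠ ⊤ := ENNReal.mul_ne_top hcT hqinv
  -- The total mass is `c + c/q = 1`.
  have hcval : (c.toReal : ℂ) = (q : ℂ) / (q + 1) := by
    have h1 := congrArg (fun m => m univ) heq
    simp only [measure_univ, Measure.add_apply, Measure.smul_apply, smul_eq_mul,
      Measure.map_apply hψ MeasurableSet.univ,
      Measure.map_apply (hψi.comp hπm) MeasurableSet.univ, preimage_univ, mul_one] at h1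
    have h2 := congrArg ENNReal.toReal h1
    rw [ENNReal.toReal_add hcT hcq, ENNReal.toReal_mul, ENNReal.toReal_inv,
      ENNReal.toReal_natCast, ENNReal.toReal_one] at h2
    have h3 : c.toReal = (q : ℝ) / (q + 1) := by
      have : (q : ℝ) ≠ 0 := by linarith
      field_simp at h2 ⊢
      linarith
    rw [h3]
    push_cast
    rfl
  have hf1 : IsFiniteMeasure (c • (haarOnIntegers K).map chart) := Measure.smul_finite _ hcT
  have hf2 : IsFiniteMeasure ((c * (q : ENNReal)⁻¹) •
      (haarOnIntegers K).map (chartInfty ∘ fun x => π * x)) := Measure.smul_finite _ hcq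
  have hball : MeasurableSet {x : K | ‖x‖ < 1} :=
    (isOpen_lt continuous_norm continuous_const).measurableSet
  have hA := measurableSet_image_chart (measurableSet_integers (K := K))
  have hB : MeasurableSet (chartInfty '' {x : K | ‖x‖ < 1}) := by
    rw [← compl_image_chart]
    exact hA.compl
  have hcross : CrossOne (sphWeight β) (c • (haarOnIntegers K).map chart)
      ((c * (q : ENNReal)⁻¹) • (haarOnIntegers K).map (chartInfty ∘ fun x => π * x)) := by
    refine ⟨chart '' (integers K : Set K), chartInfty '' {x | ‖x‖ < 1},
      Measure.ae_smul_measure ?_ _, Measure.ae_smul_measure ?_ _, ?_⟩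
    · refine (ae_map_iff (p := fun x => x ∈ chart '' (integers K : Set K)) hψ.aemeasurable hA).2 ?_
      filter_upwards [haarOnIntegers_ae_mem] with x hx
      exact mem_image_of_mem _ hx
    · refine (ae_map_iff (p := fun x => x ∈ chartInfty '' {x : K | ‖x‖ < 1})
        (hψi.comp hπm).aemeasurable hB).2 ?_
      filter_upwards [haarOnIntegers_ae_mem] with x hx
      exact mem_image_of_mem _ (norm_mul_lt_one hπ1 hx)
    · rintro _ ⟨x, hx, rfl⟩ _ ⟨y, hy, rfl⟩
      simp [sphWeight, sphDist_comm (chartInfty y), sphDist_chart_chartInfty hx hy]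
  have hw1 : ∀ x ∈ (integers K : Set K), ∀ y ∈ (integers K : Set K),
      sphWeight β (chart x) (chart y) = 1 * normWeight β x y := fun x hx y hy => by
    rw [sphWeight, sphDist_chart hx hy, one_mul, normWeight]
  have hw2 : ∀ x ∈ (integers K : Set K), ∀ y ∈ (integers K : Set K),
      sphWeight β ((chartInfty ∘ fun x => π * x) x) ((chartInfty ∘ fun x => π * x) y) =
        (((q : ℝ)⁻¹ : ℝ) : ℂ) ^ β * normWeight β x y := fun x hx y hy => by
    rw [Function.comp, Function.comp, sphWeight, sphDist_chartInfty (norm_mul_lt_one hπ1 hx).le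
      (norm_mul_lt_one hπ1 hy).le, ← mul_sub, norm_mul, hπ,
      mul_norm_cpow (by positivity) _ (norm_nonneg _), normWeight]
  have hi : ∀ k ≤ N, PairIntegrable (normWeight β) (haarOnIntegers K) k := fun k hk =>
    pairIntegrable_normWeight hK hβ hk
  have hm := measurable_sphWeight (K := K) β
  have hi1 : ∀ k ≤ N, PairIntegrable (sphWeight β) (c • (haarOnIntegers K).map chart) k :=
    fun k hk => (hi k hk).scale hψ hm hcT haarOnIntegers_ae_mem hw1
  have hi2 : ∀ k ≤ N, PairIntegrable (sphWeight β) ((c * (q : ENNReal)⁻¹) •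
      (haarOnIntegers K).map (chartInfty ∘ fun x => π * x)) k :=
    fun k hk => (hi k hk).scale (hψi.comp hπm) hm hcq haarOnIntegers_ae_mem hw2
  rw [heq]
  refine ⟨PairIntegrable.add hcross hi1 hi2, ?_⟩
  rw [pairIntegral_add hcross hi1 hi2, Finset.mul_sum]
  refine Finset.sum_congr rfl fun k hk => ?_
  have hk' : k ≤ N := Nat.lt_succ_iff.1 (Finset.mem_range.1 hk)
  rw [pairIntegral_scale hψ hm hcT haarOnIntegers_ae_mem hw1,
    pairIntegral_scale (hψi.comp hπm) hm hcq haarOnIntegers_ae_mem hw2,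
    ← inv_pow_mul_cpow_pow (by omega : 0 < q), ENNReal.toReal_mul, ENNReal.toReal_inv,
    ENNReal.toReal_natCast]
  have hpow : ((q : ℂ) / (q + 1)) ^ N = (c.toReal : ℂ) ^ k * (c.toReal : ℂ) ^ (N - k) := by
    rw [← hcval, ← pow_add, Nat.add_sub_cancel' hk']
  rw [hpow]
  simp only [one_pow, mul_one, RCLike.ofReal_mul, RCLike.ofReal_inv, RCLike.ofReal_natCast,
    mul_pow, Complex.coe_algebraMap]
  push_cast
  ring

/-- The reflection `k ↦ N - k` preserves `f (N - k) * f k` and changes the sign of `1 - 2k/N`.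
Averaging the sum with its reflection gives the cosine. -/
theorem sum_mul_exp_eq_sum_mul_cosh (N : ℕ) (f : ℕ → ℂ) (a : ℂ) (hN : N ≠ 0) :
    ∑ k ∈ Finset.range (N + 1), f (N - k) * f k * Complex.exp (-(a * (1 - 2 * (k : ℂ) / N))) =
      ∑ k ∈ Finset.range (N + 1), Complex.cosh (a * (1 - 2 * (k : ℂ) / N)) * f (N - k) * f k := by
  have hN' : (N : ℂ) ≠ 0 := by exact_mod_cast hN
  have hrefl : ∑ k ∈ Finset.range (N + 1),
        f (N - k) * f k * Complex.exp (-(a * (1 - 2 * (k : ℂ) / N))) =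
      ∑ k ∈ Finset.range (N + 1), f (N - k) * f k * Complex.exp (a * (1 - 2 * (k : ℂ) / N)) := by
    rw [← Finset.sum_range_reflect]
    refine Finset.sum_congr rfl fun k hk => ?_
    have hk' : k ≤ N := Nat.lt_succ_iff.1 (Finset.mem_range.1 hk)
    rw [Nat.add_sub_cancel, Nat.sub_sub_self hk', mul_comm (f k)]
    congr 2
    rw [Nat.cast_sub hk']
    field_simp
    ring
  have h2 : ∀ x y : ℂ, x = y → x = (x + y) / 2 := fun x y h => by rw [h]; ring
  rw [h2 _ _ hrefl, ← Finset.sum_add_distrib, Finset.sum_div]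
  refine Finset.sum_congr rfl fun k _ => ?_
  rw [Complex.cosh]
  ring

/-- With `s = q^(1/2)` this reads `s² / (s² + 1) · s⁻¹ = (s + s⁻¹)⁻¹`. -/
theorem div_add_one_mul_exp {q : ℕ} (hq : 0 < q) :
    (q : ℂ) / (q + 1) * Complex.exp (-((Real.log q : ℂ) / 2)) =
      (2 * Complex.cosh ((Real.log q : ℂ) / 2))⁻¹ := by
  set s := Complex.exp ((Real.log q : ℂ) / 2) with hs
  have hs0 : s ≠ 0 := Complex.exp_ne_zero _
  have hqs : (q : ℂ) = s * s := by
    rw [hs, ← Complex.exp_add, add_halves, ← Complex.ofReal_exp,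
      Real.exp_log (by exact_mod_cast hq)]
    simp
  have h1 : (q : ℂ) + 1 ≠ 0 := by exact_mod_cast q.succ_ne_zero
  rw [hqs] at h1 ⊢
  rw [Complex.cosh, Complex.exp_neg, ← hs]
  field_simp

theorem pairIntegral_projMeasure (hK : HasCanonicalNorm K) {N : ℕ} (hN : 2 ≤ N) {β : ℂ}
    (hβ : -2 / (N : ℝ) < β.re) :
    pairIntegral (sphWeight β) (projMeasure K) N = formulaProj N β (residueCard K) := by
  obtain ⟨hq, -⟩ := hK.exists_uniformizer
  rw [(pairIntegral_sphWeight (projMeasure_isInvariantProbability K) hK hβ).2, formulaProj]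
  set q := residueCard K with hqdef
  set t : ℂ := (Real.log q : ℂ) with ht
  have hterm : ∀ k ∈ Finset.range (N + 1), (N.choose k : ℂ) *
      (pairIntegral (normWeight β) (haarOnIntegers K) k *
        (Complex.exp (-(t * expo (N - k) β)) *
          pairIntegral (normWeight β) (haarOnIntegers K) (N - k))) =
      N.factorial * Complex.exp (-(t / 2)) ^ N *
        (F (N - k) (Real.log q) β * F k (Real.log q) β *
          Complex.exp (-(t / 2 * expo N β * (1 - 2 * (k : ℂ) / N)))) := by
    intro k hk
    have hk' : k ≤ N := Nat.lt_succ_iff.1 (Finset.mem_range.1 hk)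
    rw [pairIntegral_haarOnIntegers hK hβ hk', pairIntegral_haarOnIntegers hK hβ (Nat.sub_le N k),
      ← Nat.choose_mul_factorial_mul_factorial hk', mul_assoc (t / 2),
      ← expo_sub (by omega) hk']
    -- The factor `q^(-N/2)` does not depend on `k` and joins `(q/(q+1))^N` to form the power of `2
    -- cosh (t/2)`. The remaining exponent is odd under `k ↦ N - k`.
    have he : Complex.exp (t / 2 * (k.choose 2 * β)) * Complex.exp (-(t * expo (N - k) β)) *
        Complex.exp (t / 2 * ((N - k).choose 2 * β)) =
        Complex.exp (-(t / 2)) ^ N *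
          Complex.exp (-(t / 2 * (expo (N - k) β - expo k β))) := by
      rw [← Complex.exp_nat_mul, ← Complex.exp_add, ← Complex.exp_add, ← Complex.exp_add]
      congr 1
      simp only [expo, Nat.cast_sub hk']
      ring
    simp only [← hqdef, ← ht, Nat.cast_mul]
    linear_combination (N.choose k * k.factorial * (N - k).factorial *
      F (N - k) (Real.log q) β * F k (Real.log q) β) * he
  rw [Finset.sum_congr rfl hterm, ← Finset.mul_sum,
    sum_mul_exp_eq_sum_mul_cosh N (fun k => F k (Real.log q) β) _ (by omega)]
  have hc := congrArg (fun z => z ^ N) (div_add_one_mul_exp (q := q) (by omega))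
  simp only [mul_pow (_ / _), inv_pow, ← ht] at hc
  rw [Finset.mul_sum, Finset.mul_sum, Finset.mul_sum]
  refine Finset.sum_congr rfl fun k _ => ?_
  rw [div_eq_mul_inv (Complex.cosh _), ← hc]
  ring

end Projective

/-! ### Smoothness and functional equations -/

section Formulas

theorem ofReal_cpow_eq_exp {q : ℝ} (hq : 0 < q) (s : ℂ) :
    (q : ℂ) ^ s = Complex.exp (Real.log q * s) := by
  rw [Complex.cpow_def_of_ne_zero (by exact_mod_cast hq.ne'), ← Complex.ofReal_log hq.le]

theorem contDiffOn_log_ofReal : ContDiffOn ℝ ∞ (fun q : ℝ => ((Real.log q : ℝ) : ℂ)) (Ioi 0) :=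
  Complex.ofRealCLM.contDiff.comp_contDiffOn
    (Real.contDiffOn_log.mono fun _ hq => (ne_of_gt hq : _))

theorem contDiffOn_F_log {N : ℕ} {β : ℂ} (hβ : -2 / (N : ℝ) < β.re) {n : ℕ} (hn : n ≤ N) :
    ContDiffOn ℝ ∞ (fun q : ℝ => F n (Real.log q) β) (Ioi 0) :=
  (contDiff_F hβ hn).comp_contDiffOn (Real.contDiffOn_log.mono fun _ hq => (ne_of_gt hq : _))

theorem contDiffOn_formulaR {N : ℕ} {β : ℂ} (hβ : -2 / (N : ℝ) < β.re) :
    ContDiffOn ℝ ∞ (formulaR N β) (Ioi 0) := by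
  have h1 : ContDiffOn ℝ ∞ (fun q : ℝ => (N.factorial : ℂ) *
      Complex.exp (Real.log q * ((1 / 2 : ℂ) * (N.choose 2 : ℂ) * β)) * F N (Real.log q) β)
      (Ioi 0) :=
    (contDiffOn_const.mul (contDiffOn_log_ofReal.mul contDiffOn_const).cexp).mul
      (contDiffOn_F_log hβ le_rfl)
  refine h1.congr fun q hq => ?_
  rw [formulaR, ofReal_cpow_eq_exp hq]

theorem two_mul_cosh_half_ne_zero (t : ℝ) : 2 * Complex.cosh ((t : ℂ) / 2) ≠ 0 := by
  have h : Complex.cosh ((t : ℂ) / 2) = ((Real.cosh (t / 2) : ℝ) : ℂ) := by push_cast; rfl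
  rw [h]
  exact mul_ne_zero two_ne_zero (by exact_mod_cast (Real.cosh_pos _).ne')

theorem contDiffOn_formulaProj {N : ℕ} {β : ℂ} (hβ : -2 / (N : ℝ) < β.re) :
    ContDiffOn ℝ ∞ (formulaProj N β) (Ioi 0) := by
  unfold formulaProj
  have hcosh : ContDiff ℝ ∞ Complex.cosh :=
    (Complex.contDiff_cosh (n := ∞)).restrict_scalars ℝ
  refine contDiffOn_const.mul (ContDiffOn.sum fun k hk => ?_)
  have hk' : k ≤ N := Nat.lt_succ_iff.1 (Finset.mem_range.1 hk)
  have hL := contDiffOn_log_ofReal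
  simp only [div_eq_mul_inv _ ((2 * Complex.cosh _) ^ N)]
  refine ((ContDiffOn.mul ?_ ?_).mul (contDiffOn_F_log hβ (Nat.sub_le N k))).mul
    (contDiffOn_F_log hβ hk')
  · exact hcosh.comp_contDiffOn (((hL.div_const 2).mul contDiffOn_const).mul contDiffOn_const)
  · refine ContDiffOn.inv ((contDiffOn_const.mul (hcosh.comp_contDiffOn (hL.div_const 2))).pow N)
      fun q _ => pow_ne_zero N (two_mul_cosh_half_ne_zero _)

theorem formulaR_inv (N : ℕ) (β : ℂ) {q : ℝ} (hq : 0 < q) :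
    formulaR N β q⁻¹ = (q : ℂ) ^ (-((N.choose 2 : ℂ) * β)) * formulaR N β q := by
  rw [formulaR, formulaR, ofReal_cpow_eq_exp (inv_pos.2 hq), ofReal_cpow_eq_exp hq,
    ofReal_cpow_eq_exp hq, Real.log_inv, F_neg]
  have : Complex.exp (((-Real.log q : ℝ) : ℂ) * (1 / 2 * (N.choose 2 : ℂ) * β)) =
      Complex.exp (Real.log q * -((N.choose 2 : ℂ) * β)) *
        Complex.exp (Real.log q * (1 / 2 * (N.choose 2 : ℂ) * β)) := by
    rw [← Complex.exp_add, Complex.ofReal_neg]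
    congr 1
    ring
  rw [this]
  ring

theorem formulaProj_inv (N : ℕ) (β : ℂ) (q : ℝ) : formulaProj N β q⁻¹ = formulaProj N β q := by
  simp only [formulaProj, Real.log_inv, F_neg, Complex.ofReal_neg, neg_div, neg_mul,
    Complex.cosh_neg]

end Formulas

end LogCoulomb

theorem theorem2p5 (K : Type*) [NontriviallyNormedField K] [IsUltrametricDist K]
    [LocallyCompactSpace K] [MeasurableSpace K] [BorelSpace K]
    (hK : LogCoulomb.HasCanonicalNorm K)
    (N : ℕ) (hN : 2 ≤ N) (β : ℂ) (hβ : -2 / (N : ℝ) < β.re) :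
    -- the integral over `R^N` converges absolutely and is given by the first formula
    (Integrable (LogCoulomb.density (fun x y : K => ‖x - y‖) N β)
        (Measure.pi fun _ : Fin N => LogCoulomb.haarOnIntegers K) ∧
      LogCoulomb.partitionFunction (fun x y : K => ‖x - y‖) (LogCoulomb.haarOnIntegers K) N β =
        LogCoulomb.formulaR N β (LogCoulomb.residueCard K)) ∧
    -- the integral over `P¹(K)^N` converges absolutely and is given by the second formula
    (Integrable (LogCoulomb.density (LogCoulomb.sphDist (K := K)) N β)
        (Measure.pi fun _ : Fin N => LogCoulomb.projMeasure K) ∧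
      LogCoulomb.partitionFunction (LogCoulomb.sphDist (K := K)) (LogCoulomb.projMeasure K) N β =
        LogCoulomb.formulaProj N β (LogCoulomb.residueCard K)) ∧
    -- the formulas are smooth functions of `q ∈ (0, ∞)`
    ContDiffOn ℝ ∞ (LogCoulomb.formulaR N β) (Ioi 0) ∧
    ContDiffOn ℝ ∞ (LogCoulomb.formulaProj N β) (Ioi 0) ∧
    -- and satisfy the functional equations under `q ↦ 1 / q`
    (∀ q : ℝ, 0 < q → LogCoulomb.formulaR N β q⁻¹ =
        (q : ℂ) ^ (-((N.choose 2 : ℂ) * β)) * LogCoulomb.formulaR N β q) ∧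
    (∀ q : ℝ, 0 < q → LogCoulomb.formulaProj N β q⁻¹ = LogCoulomb.formulaProj N β q) := by
  have hq := hK.exists_uniformizer.1
  refine ⟨⟨?_, ?_⟩, ⟨?_, ?_⟩, LogCoulomb.contDiffOn_formulaR hβ,
    LogCoulomb.contDiffOn_formulaProj hβ, fun q hq => LogCoulomb.formulaR_inv N β hq,
    fun q _ => LogCoulomb.formulaProj_inv N β q⟩
  · rw [LogCoulomb.density_eq_pairProd]
    exact LogCoulomb.pairIntegrable_normWeight hK hβ le_rfl
  · rw [LogCoulomb.partitionFunction, LogCoulomb.density_eq_pairProd]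
    refine (LogCoulomb.pairIntegral_haarOnIntegers hK hβ le_rfl).trans ?_
    rw [LogCoulomb.formulaR,
      LogCoulomb.ofReal_cpow_eq_exp (by exact_mod_cast (by omega : 0 < LogCoulomb.residueCard K))]
    congr 3
    ring
  · rw [LogCoulomb.density_eq_pairProd]
    exact (LogCoulomb.pairIntegral_sphWeight
      (LogCoulomb.projMeasure_isInvariantProbability K) hK hβ).1
  · rw [LogCoulomb.partitionFunction, LogCoulomb.density_eq_pairProd]
    exact LogCoulomb.pairIntegral_projMeasure hK hN hβ
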